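/- Let $\beta\ge 1$ be an integer, let $I\subseteq\mathbb{R}$ be an interval with non-empty interior, and let $L>0$, $c\in\mathbb{R}$. A probability density $P$ over $I$ is called $\beta$-smooth if it is $\beta$ times differentiable on $I$, $P^{(\beta-1)}$ is (locally) absolutely continuous, and $\int_I (P^{(\beta)}(x))^2\,dx<\infty$. A vector $\Delta=(\Delta_1,\dots,\Delta_n)$ of non-negative reals is called regular (with constant $c$) if it is non-increasing, $\Delta_{i-1}/\Delta_i\le c$ for $i=2,\dots,n-1$, and $\Delta_i=0$ if and only if $i=n$. Write $\|\cdot\|$ for the norm of $L_2(I)$, and for a regular vector $\Delta$ let $\mathcal{S}_n(\Delta,\beta)=\mathcal{S}_n(\Delta,\beta,L,I)$ be the family of all product distributions $S=P_1\times\dots\times P_n$ on $I^n$ such that every $P_i$ has a $\beta$-smooth density (also denoted $P_i$) with $\|P_i^{(\beta)}\|\le L$, and $\|P_i-P_n\|\le\Delta_i$ for all $i=1,\dots,n$. Then there are constants $C_1,C_2>0$, depending only on $\beta$, $I$, $L$ and $c$, such that for every $n\ge 1$ and every regular vector $\Delta=(\Delta_1,\dots,\Delta_n)$ with constant $c$ the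 following holds. Put $$r^*=\max\Big\{r\in\{1,\dots,n\}:\ \Delta_{n-r+1}\le (1/r)^{\beta/(2\beta+1)}\Big\}.$$ Then $$C_1\,(r^*)^{-\frac{2\beta}{2\beta+1}}\ \le\ \inf_{\hat\theta}\ \sup_{S\in\mathcal{S}_n(\Delta,\beta)}\ \mathbb{E}_{(X_1,\dots,X_n)\sim S}\big\|P_n-\hat\theta(X_1,\dots,X_n)\big\|^2\ \le\ C_2\,(r^*)^{-\frac{2\beta}{2\beta+1}},$$ where the infimum is over all (measurable) estimators $\hat\theta$ mapping a sample $(X_1,\dots,X_n)$ to a real function on $I$. -/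

import Mathlib

open MeasureTheory Set
open scoped ENNReal

noncomputable section

namespace DriftDensity

/-- The `L₂` distance of two real functions over the interval `I`
(for functions whose difference is not square integrable on `I` it is `∞`). -/
def L2Dist (I : Set ℝ) (f g : ℝ → ℝ) : ℝ≥0∞ :=
  eLpNorm (fun x => f x - g x) 2 (volume.restrict I)

/-- `P` is a probability density over `I` (only the values of `P` on `I` matter). -/
structure IsDensity (I : Set ℝ) (P : ℝ → ℝ) : Prop where
  nonneg : ∀ x ∈ I, 0 ≤ P x
  integral_eq_one : ∫⁻ x in I, ENNReal.ofReal (P x) = 1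

/-- `P` is a `β`-smooth density over the interval `I`: it is a density, it is `β` times
differentiable on `I` (one-sidedly at endpoints which belong to `I`), `P^(β-1)` is absolutely
continuous on the compact subintervals of `I`, and `∫_I (P^(β))² < ∞`. -/
structure IsSmoothDensity (β : ℕ) (I : Set ℝ) (P : ℝ → ℝ) : Prop where
  density : IsDensity I P
  differentiable : ∀ k < β, DifferentiableOn ℝ (iteratedDerivWithin k P I) I
  absolutelyContinuous : ∀ a ∈ I, ∀ b ∈ I,
    AbsolutelyContinuousOnInterval (iteratedDerivWithin (β - 1) P I) a b
  finite : eLpNorm (iteratedDerivWithin β P I) 2 (volume.restrict I) < ∞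

/-- The conditions on the numbers `Δ 1, …, Δ n` alone in the notion of a regular drift sequence
with constant `c` (the values of `Δ` outside `{1, …, n}` play no role). -/
structure IsRegularSequence (c : ℝ) (n : ℕ) (Δ : ℕ → ℝ) : Prop where
  nonneg : ∀ i ∈ Icc 1 n, 0 ≤ Δ i
  antitone : AntitoneOn Δ (Icc 1 n)
  ratio_le : ∀ i ∈ Icc 2 (n - 1), Δ (i - 1) / Δ i ≤ c
  eq_zero_iff : ∀ i ∈ Icc 1 n, (Δ i = 0 ↔ i = n)

/-- `Δ 1, …, Δ n` is a regular drift sequence, with constant `c`, for the product distribution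
with components `P 1, …, P n`, with respect to the distance `d`. -/
structure IsRegularDriftSequence {α : Type*} (d : α → α → ℝ≥0∞) (c : ℝ) (n : ℕ) (Δ : ℕ → ℝ)
    (P : ℕ → α) : Prop where
  drift_le : ∀ i ∈ Icc 1 n, d (P i) (P n) ≤ ENNReal.ofReal (Δ i)
  regular : IsRegularSequence c n Δ

/-- The family of product distributions with component densities `P 1, …, P n` over `I` that are
`β`-smooth with `‖P_i^(β)‖_{L₂(I)} ≤ L` and have `Δ` as a regular drift sequence (constant `c`)
in the `L₂` distance. -/
def smoothFamily (β : ℕ) (L : ℝ) (I : Set ℝ) (c : ℝ) (n : ℕ) (Δ : ℕ → ℝ) : Set (ℕ → ℝ → ℝ) :=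
  {P | (∀ i ∈ Icc 1 n, IsSmoothDensity β I (P i) ∧
          eLpNorm (iteratedDerivWithin β (P i) I) 2 (volume.restrict I) ≤ ENNReal.ofReal L) ∧
        IsRegularDriftSequence (L2Dist I) c n Δ P}

/-- The distribution on `ℝ`, concentrated on `I`, that has density `P` over `I`. -/
def densityMeasure (I : Set ℝ) (P : ℝ → ℝ) : Measure ℝ :=
  (volume.restrict I).withDensity fun x => ENNReal.ofReal (P x)

/-- The law `P 1 × ⋯ × P n` of the sample `(X_1, …, X_n)`. -/
def sampleLaw (I : Set ℝ) (n : ℕ) (P : ℕ → ℝ → ℝ) : Measure (Finset.Icc 1 n → ℝ) :=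
  Measure.pi fun i => densityMeasure I (P i)

/-- An estimator of a density from `n` samples: it maps a sample to a real function, measurably
in the sample and the argument together. -/
def Estimator (n : ℕ) : Type :=
  {T : (Finset.Icc 1 n → ℝ) → ℝ → ℝ // Measurable (Function.uncurry T)}

/-- The mean integrated squared error `E ‖P_n - T(X_1, …, X_n)‖²` of the estimator `T`. -/
def risk (I : Set ℝ) (n : ℕ) (P : ℕ → ℝ → ℝ) (T : Estimator n) : ℝ≥0∞ :=
  ∫⁻ X, L2Dist I (P n) (T.1 X) ^ 2 ∂(sampleLaw I n P)

/-- The minimax risk for estimating the last component over the smooth family. -/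
def minimaxRisk (β : ℕ) (L : ℝ) (I : Set ℝ) (c : ℝ) (n : ℕ) (Δ : ℕ → ℝ) : ℝ≥0∞ :=
  ⨅ T : Estimator n, ⨆ P ∈ smoothFamily β L I c n Δ, risk I n P T

/-- The window sizes `r ∈ {1, …, n}` with `Δ_{n-r+1} ≤ (1/r)^{β/(2β+1)}`. -/
def admissibleWindows (β n : ℕ) (Δ : ℕ → ℝ) : Set ℕ :=
  {r | r ∈ Icc 1 n ∧ Δ (n - r + 1) ≤ (1 / (r : ℝ)) ^ ((β : ℝ) / (2 * β + 1))}

end DriftDensity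

end

/-! Upper bound. Average a kernel estimate over the last `r` observations. Its integrated squared
error is at most a variance of order `1 / (r h)`, a squared smoothing bias of order `h ^ (2β)` and a
squared drift of at most `Δ_{n-r+1} ^ 2`. The bandwidth `h ≍ r ^ (-1/(2β+1))` balances the first two
at `r ^ (-2β/(2β+1))`, and admissibility of `r` says exactly that the drift term is no larger than
this. The kernel looks to one side only, towards the middle of `I`, so the bias has no boundary
effect; it is controlled in `L₂` by Taylor's formula with integral remainder
(`enorm_sub_taylor_le`), and `risk_kernelEstimator_le` collects the three terms.

Lower bound. If `r` is the largest admissible window, then every component before the last `r` is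
allowed to differ from `P_n` by more than `(r+1) ^ (-β/(2β+1))`. Those components can therefore be
frozen at one fixed density `P₀`, and only `r` observations carry information about `P_n`. The last
`r` components are `P₀` plus a sum of some of `N ≍ r ^ (1/(2β+1))` small waves on disjoint cells
where `P₀` is constant. Amplitude `≍ N ^ (-β)` keeps the `β`-th derivative bounded in `L₂` and the
total perturbation below the permitted drift. It also gives each wave a squared norm `D` of order at
most `1 / r`, so the laws of the sample at two vertices differing in one wave have Hellinger
affinity at least `1/2`. Le Cam's inequality on each cell (`mul_sq_affinity_le`,
`le_pair_cellRisk`), averaged over the hypercube as in Assouad's lemma (`le_iSup_risk`), forces a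
risk of order `N D ≍ r ^ (-2β/(2β+1))`. -/

namespace DriftDensity

/-! ### One-sided kernels of higher order -/

/-- A bounded kernel on `[0, 1]` of order `β`. -/
structure IsKernel (β : ℕ) (M : ℝ) (K : ℝ → ℝ) : Prop where
  measurable : Measurable K
  abs_le : ∀ u, |K u| ≤ M
  eq_zero : ∀ u ∉ Icc (0 : ℝ) 1, K u = 0
  integral_eq_one : ∫ u, K u = 1
  moment_eq_zero : ∀ k, 1 ≤ k → k < β → ∫ u, u ^ k * K u = 0

theorem IsKernel.integrable_mul {β : ℕ} {M : ℝ} {K : ℝ → ℝ} (hK : IsKernel β M K) {g : ℝ → ℝ}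
    (hg : IntegrableOn g (Icc 0 1)) : Integrable fun u => g u * K u := by
  have h1 : IntegrableOn (fun u => g u * K u) (Icc 0 1) :=
    Integrable.mul_bdd (c := M) hg hK.measurable.aestronglyMeasurable (ae_of_all _ fun u => hK.abs_le u)
  rw [← integrableOn_univ]
  refine h1.of_forall_sdiff_eq_zero MeasurableSet.univ fun u hu => ?_
  rw [hK.eq_zero u hu.2, mul_zero]

theorem IsKernel.integrable_pow_mul {β : ℕ} {M : ℝ} {K : ℝ → ℝ} (hK : IsKernel β M K) (k : ℕ) :
    Integrable fun u => u ^ k * K u :=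
  hK.integrable_mul (continuous_pow k).continuousOn.integrableOn_Icc

/-- Richardson extrapolation. Rescaling `K` to `2 K(2u)` keeps the mass and the support condition
and multiplies the `k`-th moment by `2⁻ᵏ`. An affine combination of the two keeps the moments that
already vanish and can be tuned to remove the next one. -/
theorem exists_isKernel (β : ℕ) (hβ : 1 ≤ β) : ∃ M K, IsKernel β M K := by
  induction β, hβ using Nat.le_induction with
  | base =>
    refine ⟨1, (Icc (0 : ℝ) 1).indicator 1, measurable_one.indicator measurableSet_Icc, fun u => ?_,
      fun u hu => by simp [hu], by simp, fun k h1 h2 => by omega⟩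
    by_cases hu : u ∈ Icc (0 : ℝ) 1 <;> simp [hu]
  | succ β hβ ih =>
    obtain ⟨M, K, hK⟩ := ih
    -- The factor `(1 - γ) + γ 2⁻ᵏ` is what the combination does to the `k`-th moment; `γ` makes it
    -- vanish at `k = β`.
    obtain ⟨γ, hγ⟩ : ∃ γ : ℝ, (1 - γ) + γ * (2⁻¹) ^ β = 0 := by
      have : (2⁻¹ : ℝ) ^ β < 1 := pow_lt_one₀ (by norm_num) (by norm_num) (by omega)
      refine ⟨1 / (1 - 2⁻¹ ^ β), ?_⟩
      generalize (2⁻¹ : ℝ) ^ β = q at this ⊢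
      have : (1 : ℝ) - q ≠ 0 := by linarith
      field_simp
      ring
    have hscale : ∀ k : ℕ, Integrable (fun u : ℝ => u ^ k * (2 * K (2 * u))) ∧
        ∫ u, u ^ k * (2 * K (2 * u)) = 2⁻¹ ^ k * ∫ u, u ^ k * K u := by
      intro k
      have e : (fun u : ℝ => u ^ k * (2 * K (2 * u))) =
          fun u => (2 * 2⁻¹ ^ k) * ((fun v => v ^ k * K v) (2 * u)) := by
        funext u
        simp only [mul_pow, inv_pow]
        field_simp
      rw [e]
      refine ⟨((hK.integrable_pow_mul k).comp_mul_left' (by norm_num)).const_mul _, ?_⟩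
      rw [integral_const_mul, Measure.integral_comp_mul_left (fun v => v ^ k * K v) 2]
      rw [abs_of_pos (by norm_num), smul_eq_mul]
      ring
    have hcomb : ∀ k : ℕ, ∫ u, u ^ k * ((1 - γ) * K u + γ * (2 * K (2 * u))) =
        ((1 - γ) + γ * 2⁻¹ ^ k) * ∫ u, u ^ k * K u := by
      intro k
      have e : (fun u : ℝ => u ^ k * ((1 - γ) * K u + γ * (2 * K (2 * u)))) =
          fun u => (1 - γ) * (u ^ k * K u) + γ * (u ^ k * (2 * K (2 * u))) := by
        funext u; ring
      rw [e, integral_add ((hK.integrable_pow_mul k).const_mul _) ((hscale k).1.const_mul _),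
        integral_const_mul, integral_const_mul, (hscale k).2]
      ring
    refine ⟨|1 - γ| * M + |γ| * (2 * M), fun u => (1 - γ) * K u + γ * (2 * K (2 * u)),
      ?_, fun u => ?_, fun u hu => ?_, ?_, fun k h1 h2 => ?_⟩
    · exact (hK.measurable.const_mul _).add
        (((hK.measurable.comp (measurable_const_mul 2)).const_mul _).const_mul _)
    · refine (abs_add_le _ _).trans ?_
      rw [abs_mul, abs_mul, abs_mul, abs_of_pos (two_pos : (0 : ℝ) < 2)]
      gcongr <;> exact hK.abs_le _
    · rw [hK.eq_zero u hu, hK.eq_zero (2 * u)]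
      · simp
      · simp only [mem_Icc, not_and_or, not_le] at hu ⊢
        rcases hu with hu | hu
        · left; linarith
        · right; linarith
    · have := hcomb 0
      simp only [pow_zero, one_mul, mul_one, sub_add_cancel] at this
      rw [this, hK.integral_eq_one]
    · rw [hcomb k]
      rcases (Nat.lt_succ_iff_lt_or_eq.1 h2) with h | rfl
      · rw [hK.moment_eq_zero k h1 h, mul_zero]
      · rw [hγ, zero_mul]

/-! ### Taylor's formula inside the interval -/

/-- The integral remainder formula uses derivatives within the segment from `x` to `y`, whereas
smoothness is given within `I`. A function differentiable within `I` has the same derivative within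
a nondegenerate segment of `I`, which gives the induction. -/
theorem iteratedDerivWithin_uIcc_eqOn {β : ℕ} {I : Set ℝ} (hI : I.OrdConnected) {f : ℝ → ℝ}
    (hd : ∀ k < β, DifferentiableOn ℝ (iteratedDerivWithin k f I) I) {x y : ℝ} (hx : x ∈ I)
    (hy : y ∈ I) (hxy : x ≠ y) : ∀ k ≤ β,
    EqOn (iteratedDerivWithin k f (uIcc x y)) (iteratedDerivWithin k f I) (uIcc x y) := by
  intro k
  induction k with
  | zero => intro _ t _; simp
  | succ k ih =>
    intro hk t ht
    rw [iteratedDerivWithin_succ, iteratedDerivWithin_succ,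
      derivWithin_congr (ih (by omega)) (ih (by omega) ht)]
    exact derivWithin_subset (hI.uIcc_subset hx hy) (uniqueDiffOn_uIcc hxy t ht)
      (hd k (by omega) t (hI.uIcc_subset hx hy ht))

/-- Taylor's formula with a bound of the remainder by the integral of the top derivative. -/
theorem enorm_sub_taylor_le {β : ℕ} (hβ : 1 ≤ β) {I : Set ℝ} (hI : I.OrdConnected) {f : ℝ → ℝ}
    (hd : ∀ k < β, DifferentiableOn ℝ (iteratedDerivWithin k f I) I)
    (hac : ∀ a ∈ I, ∀ b ∈ I, AbsolutelyContinuousOnInterval (iteratedDerivWithin (β - 1) f I) a b)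
    {x y h : ℝ} (hx : x ∈ I) (hy : y ∈ I) (hxy : |y - x| ≤ h) :
    ‖f y - ∑ k ∈ Finset.range β, ((k.factorial : ℝ)⁻¹ * (y - x) ^ k) *
        iteratedDerivWithin k f I x‖ₑ ≤
      ENNReal.ofReal (h ^ (β - 1)) *
        ∫⁻ t in I ∩ Icc (x - h) (x + h), ‖iteratedDerivWithin β f I t‖ₑ := by
  obtain ⟨b, rfl⟩ : ∃ b, β = b + 1 := ⟨β - 1, by omega⟩
  simp only [Nat.add_sub_cancel] at hac ⊢
  -- A degenerate segment has no unique derivatives, but there the Taylor sum is just `f x`.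
  rcases eq_or_ne x y with rfl | hne
  · simp [Finset.sum_range_succ']
  have hsub := hI.uIcc_subset hx hy
  have heq := iteratedDerivWithin_uIcc_eqOn hI hd hx hy hne
  have hU : UniqueDiffOn ℝ (uIcc x y) := uniqueDiffOn_uIcc hne
  have hd' : ∀ k < b + 1, DifferentiableOn ℝ (iteratedDerivWithin k f (uIcc x y)) (uIcc x y) :=
    fun k hk => ((hd k hk).mono hsub).congr (heq k hk.le)
  have hc : ContDiffOn ℝ b f (uIcc x y) := by
    refine contDiffOn_of_differentiableOn_deriv fun k hk => hd' k ?_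
    have : k ≤ b := by exact_mod_cast hk
    omega
  have hac' : AbsolutelyContinuousOnInterval (iteratedDerivWithin b f (uIcc x y)) x y := by
    have := hac x hx y hy
    rw [absolutelyContinuousOnInterval_iff] at this ⊢
    intro ε hε
    obtain ⟨δ, hδ, H⟩ := this ε hε
    refine ⟨δ, hδ, fun E hE hlt => lt_of_eq_of_lt (Finset.sum_congr rfl fun i hi => ?_) (H E hE hlt)⟩
    have := hE.1 i hi
    rw [heq b (by omega) this.1, heq b (by omega) this.2]
  have ht := taylor_integral_remainder_of_absolutelyContinuous hc hac'
  rw [taylor_within_apply] at ht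
  have e : ∑ k ∈ Finset.range (b + 1), ((k.factorial : ℝ)⁻¹ * (y - x) ^ k) *
        iteratedDerivWithin k f I x = ∑ k ∈ Finset.range (b + 1),
        ((k.factorial : ℝ)⁻¹ * (y - x) ^ k) • iteratedDerivWithin k f (uIcc x y) x := by
    refine Finset.sum_congr rfl fun k hk => ?_
    rw [heq k (Finset.mem_range.1 hk).le left_mem_uIcc, smul_eq_mul]
  rw [e, ht]
  have hle : ∀ t ∈ uIoc x y, t ∈ uIcc x y := fun t ht => uIoc_subset_uIcc ht
  calc ‖∫ t in x..y, (y - t) ^ b / (b.factorial : ℝ) *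
          iteratedDerivWithin (b + 1) f (uIcc x y) t‖ₑ
      = ‖∫ t in uIoc x y, (y - t) ^ b / (b.factorial : ℝ) *
          iteratedDerivWithin (b + 1) f (uIcc x y) t‖ₑ := by
        rw [← ofReal_norm, ← ofReal_norm,
          intervalIntegral.norm_intervalIntegral_eq]
    _ ≤ ∫⁻ t in uIoc x y, ‖(y - t) ^ b / (b.factorial : ℝ) *
          iteratedDerivWithin (b + 1) f (uIcc x y) t‖ₑ := enorm_integral_le_lintegral_enorm _
    _ ≤ ∫⁻ t in uIoc x y, ENNReal.ofReal (h ^ b) * ‖iteratedDerivWithin (b + 1) f I t‖ₑ := by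
        refine setLIntegral_mono' measurableSet_uIoc fun t ht => ?_
        rw [heq (b + 1) le_rfl (hle t ht), enorm_mul]
        gcongr
        rw [← ofReal_norm]
        apply ENNReal.ofReal_le_ofReal
        rw [Real.norm_eq_abs, abs_div, abs_pow, Nat.abs_cast]
        have h1 : |y - t| ≤ h := (abs_sub_right_of_mem_uIcc (hle t ht)).trans hxy
        refine (div_le_self (by positivity) (by exact_mod_cast Nat.one_le_iff_ne_zero.2 b.factorial_ne_zero)).trans ?_
        gcongr
    _ = ENNReal.ofReal (h ^ b) * ∫⁻ t in uIoc x y, ‖iteratedDerivWithin (b + 1) f I t‖ₑ :=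
        lintegral_const_mul' _ _ ENNReal.ofReal_ne_top
    _ ≤ _ := by
        gcongr
        intro t ht
        refine ⟨hsub (hle t ht), ?_⟩
        have h1 : |t - x| ≤ h := (abs_sub_left_of_mem_uIcc (hle t ht)).trans hxy
        rw [abs_le] at h1
        constructor <;> linarith

/-! ### Cauchy–Schwarz and sliding windows in `L₂` -/

theorem sq_lintegral_mul_le {α : Type*} [MeasurableSpace α] {μ : Measure α} {f g : α → ℝ≥0∞}
    (hf : AEMeasurable f μ) (hg : AEMeasurable g μ) :
    (∫⁻ a, f a * g a ∂μ) ^ 2 ≤ (∫⁻ a, f a ^ 2 ∂μ) * ∫⁻ a, g a ^ 2 ∂μ := by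
  have h := ENNReal.lintegral_mul_le_Lp_mul_Lq μ Real.HolderConjugate.two_two hf hg
  simp only [ENNReal.rpow_two, Pi.mul_apply] at h
  calc (∫⁻ a, f a * g a ∂μ) ^ 2
      ≤ ((∫⁻ a, f a ^ 2 ∂μ) ^ (1 / 2 : ℝ) * (∫⁻ a, g a ^ 2 ∂μ) ^ (1 / 2 : ℝ)) ^ 2 := by gcongr
    _ = _ := by
      rw [mul_pow, ← ENNReal.rpow_two, ← ENNReal.rpow_two, ← ENNReal.rpow_mul, ← ENNReal.rpow_mul]
      norm_num

theorem sq_lintegral_le {α : Type*} [MeasurableSpace α] {μ : Measure α} {f : α → ℝ≥0∞}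
    (hf : AEMeasurable f μ) :
    (∫⁻ a, f a ∂μ) ^ 2 ≤ μ univ * ∫⁻ a, f a ^ 2 ∂μ := by
  simpa using sq_lintegral_mul_le (μ := μ) (f := fun _ => 1) aemeasurable_const hf

theorem enorm_sq_eq_ofReal (a : ℝ) : ‖a‖ₑ ^ 2 = ENNReal.ofReal (a ^ 2) := by
  rw [← ofReal_norm, ← ENNReal.ofReal_pow (norm_nonneg _), Real.norm_eq_abs, sq_abs]

theorem eLpNorm_two_sq {α : Type*} [MeasurableSpace α] (μ : Measure α) (f : α → ℝ) :
    eLpNorm f 2 μ ^ 2 = ∫⁻ a, ‖f a‖ₑ ^ 2 ∂μ := by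
  rw [eLpNorm_eq_lintegral_rpow_enorm_toReal (by norm_num) (by norm_num), ← ENNReal.rpow_two,
    ← ENNReal.rpow_mul]
  norm_num

/-- Cauchy–Schwarz on a window of length at most `2h` gives one factor `2h`. After Tonelli, a point
`t` lies in the windows of those `x` within `h` of it, which gives the second. This turns the
pointwise Taylor bound into an `L₂` bound on the bias. -/
theorem lintegral_sq_lintegral_window_le {I : Set ℝ} {g : ℝ → ℝ≥0∞}
    (hg : AEMeasurable g (volume.restrict I)) {h : ℝ} (hh : 0 < h) :
    ∫⁻ x in I, (∫⁻ t in I ∩ Icc (x - h) (x + h), g t) ^ 2 ≤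
      ENNReal.ofReal (4 * h ^ 2) * ∫⁻ t in I, g t ^ 2 := by
  set S : Set (ℝ × ℝ) := {p | p.1 - h ≤ p.2 ∧ p.2 ≤ p.1 + h} with hS
  have hSm : MeasurableSet S := by
    exact (measurableSet_le (measurable_fst.sub_const h) measurable_snd).inter
      (measurableSet_le measurable_snd (measurable_fst.add_const h))
  have hvol : ∀ x : ℝ, volume (Icc (x - h) (x + h)) = ENNReal.ofReal (2 * h) := fun x => by
    rw [Real.volume_Icc]; congr 1; ring
  calc ∫⁻ x in I, (∫⁻ t in I ∩ Icc (x - h) (x + h), g t) ^ 2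
      ≤ ∫⁻ x in I, ENNReal.ofReal (2 * h) *
          ∫⁻ t in I, S.indicator (fun p => g p.2 ^ 2) (x, t) := by
        refine lintegral_mono fun x => ?_
        refine (sq_lintegral_le (hg.mono_set inter_subset_left)).trans ?_
        refine mul_le_mul' ?_ ?_
        · rw [Measure.restrict_apply_univ, ← hvol x]
          exact measure_mono inter_subset_right
        · rw [inter_comm I, ← Measure.restrict_restrict measurableSet_Icc,
            ← lintegral_indicator measurableSet_Icc]
          exact le_of_eq rfl
    _ = ENNReal.ofReal (2 * h) * ∫⁻ x in I,
          ∫⁻ t in I, S.indicator (fun p => g p.2 ^ 2) (x, t) :=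
        lintegral_const_mul' _ _ ENNReal.ofReal_ne_top
    _ = ENNReal.ofReal (2 * h) * ∫⁻ t in I,
          ∫⁻ x in I, S.indicator (fun p => g p.2 ^ 2) (x, t) := by
        rw [lintegral_lintegral_swap]
        exact ((hg.pow_const 2).comp_snd (μ := volume.restrict I)).indicator hSm
    _ ≤ ENNReal.ofReal (2 * h) * ∫⁻ t in I, ENNReal.ofReal (2 * h) * g t ^ 2 := by
        gcongr with t
        calc ∫⁻ x in I, S.indicator (fun p => g p.2 ^ 2) (x, t)
            ≤ ∫⁻ x, (Icc (t - h) (t + h)).indicator (fun _ => g t ^ 2) x := by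
              refine (lintegral_mono' Measure.restrict_le_self le_rfl).trans
                (lintegral_mono fun x => ?_)
              by_cases hx : (x, t) ∈ S
              · have hx' : x ∈ Icc (t - h) (t + h) := ⟨by linarith [hx.2], by linarith [hx.1]⟩
                simp [hx, hx']
              · simp [hx]
          _ = ENNReal.ofReal (2 * h) * g t ^ 2 := by
              rw [lintegral_indicator_const measurableSet_Icc, hvol, mul_comm]
    _ = _ := by
        rw [lintegral_const_mul' _ _ ENNReal.ofReal_ne_top, ← mul_assoc,
          ← ENNReal.ofReal_mul (by positivity)]
        congr 2; ring

/-! ### Kernel weights and their bias -/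

/-- The kernel weight that the observation `y` gets at the point `x`, looking to the right of `x`
if `x < m` and to the left of `x` otherwise. -/
noncomputable def kernelWeight (K : ℝ → ℝ) (m h x y : ℝ) : ℝ :=
  h⁻¹ * K ((if x < m then 1 else -1) * (y - x) / h)

theorem IsKernel.measurable_kernelWeight {β : ℕ} {M : ℝ} {K : ℝ → ℝ} (hK : IsKernel β M K)
    (m h : ℝ) : Measurable fun p : ℝ × ℝ => kernelWeight K m h p.1 p.2 := by
  refine Measurable.const_mul (hK.measurable.comp (Measurable.div_const (Measurable.mul ?_ ?_) _)) _
  · exact Measurable.ite (measurableSet_lt measurable_fst measurable_const) measurable_const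
      measurable_const
  · exact measurable_snd.sub measurable_fst

theorem IsKernel.abs_kernelWeight_le {β : ℕ} {M : ℝ} {K : ℝ → ℝ} (hK : IsKernel β M K)
    {m h : ℝ} (hh : 0 < h) (x y : ℝ) : |kernelWeight K m h x y| ≤ h⁻¹ * M := by
  rw [kernelWeight, abs_mul, abs_of_pos (inv_pos.2 hh)]
  gcongr
  exact hK.abs_le _

theorem IsKernel.nonneg {β : ℕ} {M : ℝ} {K : ℝ → ℝ} (hK : IsKernel β M K) : 0 ≤ M :=
  (abs_nonneg _).trans (hK.abs_le 0)

theorem IsKernel.kernelWeight_eq_zero {β : ℕ} {M : ℝ} {K : ℝ → ℝ} (hK : IsKernel β M K)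
    {m h : ℝ} (hh : 0 < h) {x y : ℝ} (hy : x ∉ Icc (y - h) (y + h)) :
    kernelWeight K m h x y = 0 := by
  rw [kernelWeight, hK.eq_zero, mul_zero]
  contrapose! hy
  rw [mem_Icc, le_div_iff₀ hh, div_le_iff₀ hh] at hy
  split_ifs at hy
  · constructor <;> linarith
  · constructor <;> linarith

/-- Integrating over `x` before `y` makes the bound uniform in `ν`: for fixed `y` the square is at
most `(M / h) ^ 2` on an interval of length `2h`. No upper bound on the density is needed. -/
theorem IsKernel.lintegral_kernelWeight_sq_le {β : ℕ} {M : ℝ} {K : ℝ → ℝ} (hK : IsKernel β M K)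
    {m h : ℝ} (hh : 0 < h) (I : Set ℝ) (ν : Measure ℝ) [IsProbabilityMeasure ν] :
    ∫⁻ x in I, ∫⁻ y, ENNReal.ofReal (kernelWeight K m h x y ^ 2) ∂ν ≤
      ENNReal.ofReal (2 * M ^ 2 / h) := by
  rw [lintegral_lintegral_swap]
  swap
  · exact ((hK.measurable_kernelWeight m h).pow_const 2).ennreal_ofReal.aemeasurable
  calc ∫⁻ y, (∫⁻ x in I, ENNReal.ofReal (kernelWeight K m h x y ^ 2)) ∂ν
      ≤ ∫⁻ _, ENNReal.ofReal (2 * M ^ 2 / h) ∂ν := by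
        refine lintegral_mono fun y => ?_
        calc ∫⁻ x in I, ENNReal.ofReal (kernelWeight K m h x y ^ 2)
            ≤ ∫⁻ x, (Icc (y - h) (y + h)).indicator
                (fun _ => ENNReal.ofReal ((h⁻¹ * M) ^ 2)) x := by
              refine (lintegral_mono' Measure.restrict_le_self le_rfl).trans
                (lintegral_mono fun x => ?_)
              by_cases hx : x ∈ Icc (y - h) (y + h)
              · rw [indicator_of_mem hx]
                apply ENNReal.ofReal_le_ofReal
                rw [← sq_abs]
                gcongr
                exact hK.abs_kernelWeight_le hh x y
              · rw [hK.kernelWeight_eq_zero hh hx]; simp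
          _ = ENNReal.ofReal (2 * M ^ 2 / h) := by
              rw [lintegral_indicator_const measurableSet_Icc, Real.volume_Icc,
                ← ENNReal.ofReal_mul (by positivity)]
              congr 1
              field_simp
              ring
    _ = _ := by simp

/-- The substitution `y = x + σ h u`, where `σ` is the direction of view. Nothing is lost at the
boundary of `I`, because the kernel only sees the segment from `x` to `x + σ h`. -/
theorem integral_kernelWeight_mul {β : ℕ} {M : ℝ} {K : ℝ → ℝ} (hK : IsKernel β M K)
    {I : Set ℝ} (hI : I.OrdConnected) {m h x : ℝ} (hh : 0 < h) (f : ℝ → ℝ) (hx : x ∈ I)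
    (hxh : x + (if x < m then 1 else -1) * h ∈ I) :
    ∫ y in I, kernelWeight K m h x y * f y =
      ∫ u, f (x + (if x < m then 1 else -1) * h * u) * K u := by
  set σ : ℝ := if x < m then 1 else -1 with hσ
  have hσσ : σ * σ = 1 := by rw [hσ]; split_ifs <;> norm_num
  have hσ1 : |σ| = 1 := by rw [hσ]; split_ifs <;> norm_num
  rw [← integral_indicator hI.measurableSet,
    ← integral_add_left_eq_self _ x]
  set g : ℝ → ℝ := fun z => I.indicator (fun y => kernelWeight K m h x y * f y) (x + z) with hg
  have h1 := Measure.integral_comp_mul_left g (σ * h)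
  rw [abs_inv, abs_mul, hσ1, one_mul, abs_of_pos hh, smul_eq_mul, inv_mul_eq_div,
    eq_div_iff hh.ne', ← integral_mul_const] at h1
  rw [← h1]
  refine integral_congr_ae (ae_of_all _ fun u => ?_)
  have hk : kernelWeight K m h x (x + σ * h * u) * h = K u := by
    rw [kernelWeight, ← hσ]
    have : σ * (x + σ * h * u - x) / h = u := by
      rw [add_sub_cancel_left, mul_assoc, ← mul_assoc, hσσ]; field_simp
    rw [this]; field_simp
  simp only [hg]
  -- For `u` in `[0, 1]` the point lies between two points of the convex set `I`; for other `u` both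
  -- sides vanish with the kernel.
  by_cases hu : u ∈ Icc (0 : ℝ) 1
  · have : x + σ * h * u ∈ I := by
      have := hI.convex.add_smul_sub_mem hx hxh hu
      convert this using 1
      simp; ring
    rw [indicator_of_mem this, mul_right_comm, hk, mul_comm]
  · rw [hK.eq_zero u hu] at hk ⊢
    by_cases hm : x + σ * h * u ∈ I
    · rw [indicator_of_mem hm, mul_right_comm, hk, mul_comm]
    · rw [indicator_of_notMem hm]; simp

/-- The bias of the kernel estimate at a point. -/
theorem IsKernel.enorm_bias_le {β : ℕ} (hβ : 1 ≤ β) {M : ℝ} {K : ℝ → ℝ} (hK : IsKernel β M K)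
    {I : Set ℝ} (hI : I.OrdConnected) {f : ℝ → ℝ}
    (hd : ∀ k < β, DifferentiableOn ℝ (iteratedDerivWithin k f I) I)
    (hac : ∀ a ∈ I, ∀ b ∈ I, AbsolutelyContinuousOnInterval (iteratedDerivWithin (β - 1) f I) a b)
    {m h x : ℝ} (hh : 0 < h) (hx : x ∈ I)
    (hxh : x + (if x < m then 1 else -1) * h ∈ I) :
    ‖(∫ y in I, kernelWeight K m h x y * f y) - f x‖ₑ ≤ ENNReal.ofReal (M * h ^ (β - 1)) *
      ∫⁻ t in I ∩ Icc (x - h) (x + h), ‖iteratedDerivWithin β f I t‖ₑ := by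
  rw [integral_kernelWeight_mul hK hI hh f hx hxh]
  set σ : ℝ := if x < m then 1 else -1 with hσ
  have hσ1 : |σ| = 1 := by rw [hσ]; split_ifs <;> norm_num
  have hmem : ∀ u ∈ Icc (0 : ℝ) 1, x + σ * h * u ∈ I := fun u hu => by
    have := hI.convex.add_smul_sub_mem hx hxh hu
    convert this using 1
    simp; ring
  have hfc : ContinuousOn f I := by
    have := (hd 0 (by omega)).continuousOn
    rwa [iteratedDerivWithin_zero] at this
  have hfi : Integrable fun u => f (x + σ * h * u) * K u :=
    hK.integrable_mul (ContinuousOn.integrableOn_Icc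
      (hfc.comp (by fun_prop) hmem))
  set c : ℕ → ℝ := fun k => (k.factorial : ℝ)⁻¹ * iteratedDerivWithin k f I x * (σ * h) ^ k with hc
  have hTi : ∀ k, Integrable fun u => c k * (u ^ k * K u) :=
    fun k => (hK.integrable_pow_mul k).const_mul _
  -- The kernel reproduces the Taylor polynomial at `x`: its mass returns the constant term and its
  -- vanishing moments kill the others. Only the remainder is left in the bias.
  have hT : ∫ u, ∑ k ∈ Finset.range β, c k * (u ^ k * K u) = f x := by
    rw [integral_finsetSum _ fun k _ => hTi k]
    simp_rw [integral_const_mul]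
    rw [Finset.sum_eq_single 0]
    · simp [hK.integral_eq_one, hc]
    · intro k hk h0
      rw [hK.moment_eq_zero k (by omega) (Finset.mem_range.1 hk), mul_zero]
    · intro h0; simp at h0; omega
  rw [← hT, ← integral_sub hfi (integrable_finsetSum _ fun k _ => hTi k)]
  refine (enorm_integral_le_lintegral_enorm _).trans ?_
  set B := ∫⁻ t in I ∩ Icc (x - h) (x + h), ‖iteratedDerivWithin β f I t‖ₑ
  calc _ ≤ ∫⁻ u, (Icc (0 : ℝ) 1).indicator
        (fun _ => ENNReal.ofReal (M * h ^ (β - 1)) * B) u := by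
        refine lintegral_mono fun u => ?_
        by_cases hu : u ∈ Icc (0 : ℝ) 1
        · rw [indicator_of_mem hu]
          have hle : |x + σ * h * u - x| ≤ h := by
            rw [add_sub_cancel_left, abs_mul, abs_mul, hσ1, one_mul, abs_of_pos hh,
              abs_of_nonneg hu.1]
            exact mul_le_of_le_one_right hh.le hu.2
          have ht := enorm_sub_taylor_le hβ hI hd hac hx (hmem u hu) hle
          have e : f (x + σ * h * u) * K u - ∑ k ∈ Finset.range β, c k * (u ^ k * K u) =
              K u * (f (x + σ * h * u) - ∑ k ∈ Finset.range β,
              ((k.factorial : ℝ)⁻¹ * (x + σ * h * u - x) ^ k) * iteratedDerivWithin k f I x) := by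
            rw [mul_sub, Finset.mul_sum, mul_comm]
            congr 1
            refine Finset.sum_congr rfl fun k _ => ?_
            rw [add_sub_cancel_left, mul_pow, hc]
            ring
          rw [e, enorm_mul, ENNReal.ofReal_mul hK.nonneg, mul_assoc (ENNReal.ofReal M)]
          refine mul_le_mul' ?_ ht
          rw [← ofReal_norm]
          exact ENNReal.ofReal_le_ofReal (hK.abs_le u)
        · simp [hu, hK.eq_zero u hu]
    _ = _ := by rw [lintegral_indicator_const measurableSet_Icc]; simp

/-- The derivative within `I` is the ordinary one off the frontier, which is null for a convex set,
and `deriv` of any real function is measurable. -/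
theorem aemeasurable_iteratedDerivWithin {β : ℕ} (hβ : 1 ≤ β) {I : Set ℝ} (hI : I.OrdConnected)
    (f : ℝ → ℝ) : AEMeasurable (iteratedDerivWithin β f I) (volume.restrict I) := by
  obtain ⟨b, rfl⟩ : ∃ b, β = b + 1 := ⟨β - 1, by omega⟩
  refine (measurable_deriv (iteratedDerivWithin b f I)).aemeasurable.congr ?_
  have h0 : volume (frontier I) = 0 := hI.convex.addHaar_frontier volume
  have h1 : ∀ᵐ t, t ∉ frontier I := measure_eq_zero_iff_ae_notMem.1 h0
  rw [Filter.EventuallyEq, ae_restrict_iff' hI.measurableSet]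
  filter_upwards [h1] with t ht htI
  have : I ∈ nhds t := by
    rw [← mem_interior_iff_mem_nhds]
    by_contra hc
    exact ht ⟨subset_closure htI, hc⟩
  rw [iteratedDerivWithin_succ, derivWithin_of_mem_nhds this]

/-! ### Risk of linear kernel estimators -/

open ProbabilityTheory in
-- Bias–variance decomposition. Under the product measure the variances of the summands add up, and
-- each is at most the second moment.
theorem lintegral_sq_sub_weighted_sum_le {ι : Type*} [Fintype ι] {ν : ι → Measure ℝ}
    [∀ i, IsProbabilityMeasure (ν i)] (w : ι → ℝ) {k : ℝ → ℝ} (hk : Measurable k) {B : ℝ}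
    (hB : ∀ y, |k y| ≤ B) (p : ℝ) :
    ∫⁻ X, ‖p - ∑ i, w i * k (X i)‖ₑ ^ 2 ∂Measure.pi ν ≤
      ENNReal.ofReal (∑ i, w i ^ 2 * ∫ y, k y ^ 2 ∂ν i + (∑ i, w i * (∫ y, k y ∂ν i) - p) ^ 2) := by
  have hmem : ∀ i, MemLp (fun y => w i * k y) 2 (ν i) := fun i =>
    (MemLp.of_bound hk.aestronglyMeasurable B (ae_of_all _ fun y => hB y)).const_mul _
  set Y : (ι → ℝ) → ℝ := fun X => ∑ i, w i * k (X i) with hY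
  have hYeq : (∑ i, fun X : ι → ℝ => w i * k (X i)) = Y := by
    funext X; simp [hY]
  have hcomp : ∀ i, MemLp (fun X : ι → ℝ => w i * k (X i)) 2 (Measure.pi ν) := fun i =>
    (hmem i).comp_measurePreserving (measurePreserving_eval ν i)
  have hYmem : MemLp Y 2 (Measure.pi ν) := memLp_finsetSum _ fun i _ => hcomp i
  have hvar : Var[Y; Measure.pi ν] ≤ ∑ i, w i ^ 2 * ∫ y, k y ^ 2 ∂ν i := by
    rw [← hYeq, variance_sum_pi (X := fun i y => w i * k y) hmem]
    refine Finset.sum_le_sum fun i _ => ?_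
    refine (variance_le_expectation_sq (hmem i).1).trans (le_of_eq ?_)
    rw [← integral_const_mul]
    refine integral_congr_ae (ae_of_all _ fun y => ?_)
    simp [mul_pow]
  have hmean : ∫ X, Y X ∂Measure.pi ν = ∑ i, w i * ∫ y, k y ∂ν i := by
    rw [hY, integral_finsetSum _ fun i _ => (hcomp i).integrable (by norm_num)]
    refine Finset.sum_congr rfl fun i _ => ?_
    rw [integral_const_mul,
      integral_comp_eval (μ := ν) (i := i) (f := k) hk.aestronglyMeasurable]
  have hsq : ∫ X, (p - Y X) ^ 2 ∂Measure.pi ν =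
      Var[Y; Measure.pi ν] + ((∫ X, Y X ∂Measure.pi ν) - p) ^ 2 := by
    rw [variance_eq_sub hYmem]
    have e : (fun X => (p - Y X) ^ 2) = fun X => (Y ^ 2) X - (2 * p) * Y X + p ^ 2 := by
      funext X; simp; ring
    have i1 : Integrable (Y ^ 2) (Measure.pi ν) := hYmem.integrable_sq
    have i2 : Integrable (fun X => 2 * p * Y X) (Measure.pi ν) :=
      (hYmem.integrable (by norm_num)).const_mul _
    rw [e, integral_add (f := fun X => (Y ^ 2) X - 2 * p * Y X) (i1.sub i2) (integrable_const _),
      integral_sub i1 i2, integral_const_mul]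
    simp
    ring
  have hfin : Integrable (fun X => (p - Y X) ^ 2) (Measure.pi ν) :=
    ((memLp_const p).sub hYmem).integrable_sq
  calc ∫⁻ X, ‖p - Y X‖ₑ ^ 2 ∂Measure.pi ν
      = ∫⁻ X, ENNReal.ofReal ((p - Y X) ^ 2) ∂Measure.pi ν := by
        exact lintegral_congr fun X => enorm_sq_eq_ofReal _
    _ = ENNReal.ofReal (∫ X, (p - Y X) ^ 2 ∂Measure.pi ν) :=
        (ofReal_integral_eq_lintegral_ofReal hfin (ae_of_all _ fun X => sq_nonneg _)).symm
    _ ≤ _ := by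
        apply ENNReal.ofReal_le_ofReal
        rw [hsq, hmean]
        gcongr

theorem IsDensity.isProbabilityMeasure {I : Set ℝ} {P : ℝ → ℝ} (hP : IsDensity I P) :
    IsProbabilityMeasure (densityMeasure I P) :=
  ⟨by rw [densityMeasure, withDensity_apply _ MeasurableSet.univ, Measure.restrict_univ,
    hP.integral_eq_one]⟩

theorem integral_densityMeasure {I : Set ℝ} (hI : MeasurableSet I) {P : ℝ → ℝ}
    (hP : IsDensity I P) (hPm : AEMeasurable P (volume.restrict I)) (k : ℝ → ℝ) :
    ∫ y, k y ∂densityMeasure I P = ∫ y in I, k y * P y := by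
  rw [densityMeasure, integral_withDensity_eq_integral_toReal_smul₀ hPm.ennreal_ofReal
    (ae_of_all _ fun _ => ENNReal.ofReal_lt_top)]
  refine setIntegral_congr_fun hI fun y hy => ?_
  simp [ENNReal.toReal_ofReal (hP.nonneg y hy), mul_comm]

theorem IsSmoothDensity.continuousOn {β : ℕ} (hβ : 1 ≤ β) {I : Set ℝ} {P : ℝ → ℝ}
    (hP : IsSmoothDensity β I P) : ContinuousOn P I := by
  have := (hP.differentiable 0 (by omega)).continuousOn
  rwa [iteratedDerivWithin_zero] at this

/-- The linear estimator with weights `w` of the observations and kernel `K`. -/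
noncomputable def kernelEstimator {n : ℕ} (w : Finset.Icc 1 n → ℝ) {K : ℝ → ℝ} (hK : Measurable K)
    (m h : ℝ) : Estimator n :=
  ⟨fun X x => ∑ i, w i * kernelWeight K m h x (X i), by
    refine Finset.measurable_sum _ fun i _ => Measurable.const_mul ?_ _
    refine Measurable.const_mul (hK.comp (Measurable.div_const (Measurable.mul ?_ ?_) _)) _
    · exact Measurable.ite (measurableSet_lt measurable_snd measurable_const) measurable_const
        measurable_const
    · exact ((measurable_pi_apply i).comp measurable_fst).sub measurable_snd⟩

/-- As the weights sum to one, the bias is the weighted mean of the smoothing bias of `P i` plus its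
drift from `P n`. Convexity of the square and `(a + b)² ≤ 2 (a² + b²)` separate the two. -/
theorem lintegral_sq_sub_kernelEstimator_le {β : ℕ} {M : ℝ} {K : ℝ → ℝ} (hK : IsKernel β M K)
    {I : Set ℝ} {m h : ℝ} (hh : 0 < h) {n : ℕ} {w : Finset.Icc 1 n → ℝ}
    (hw : ∀ i, 0 ≤ w i) (hw1 : ∑ i, w i = 1) {P : ℕ → ℝ → ℝ}
    (hP : ∀ i : Finset.Icc 1 n, IsProbabilityMeasure (densityMeasure I (P i))) (x : ℝ) :
    ∫⁻ X, ‖P n x - (kernelEstimator w hK.measurable m h).1 X x‖ₑ ^ 2 ∂sampleLaw I n P ≤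
      ∑ i, (ENNReal.ofReal (w i ^ 2) *
          (∫⁻ y, ENNReal.ofReal (kernelWeight K m h x y ^ 2) ∂densityMeasure I (P i)) +
        ENNReal.ofReal (2 * w i) *
          (‖(∫ y, kernelWeight K m h x y ∂densityMeasure I (P i)) - P i x‖ₑ ^ 2 +
            ‖P i x - P n x‖ₑ ^ 2)) := by
  have hkm : Measurable (kernelWeight K m h x) :=
    (hK.measurable_kernelWeight m h).comp measurable_prodMk_left
  have hkb := hK.abs_kernelWeight_le (m := m) hh x
  refine (lintegral_sq_sub_weighted_sum_le w hkm hkb (P n x)).trans ?_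
  set μ := fun i : Finset.Icc 1 n => ∫ y, kernelWeight K m h x y ∂densityMeasure I (P i) with hμ
  have h1 : ∑ i, w i * μ i - P n x = ∑ i, w i * ((μ i - P i x) + (P i x - P n x)) := by
    simp only [sub_add_sub_cancel, mul_sub, Finset.sum_sub_distrib, ← Finset.sum_mul, hw1, one_mul]
  have h2 : (∑ i, w i * μ i - P n x) ^ 2 ≤
      ∑ i, 2 * w i * ((μ i - P i x) ^ 2 + (P i x - P n x) ^ 2) := by
    rw [h1]
    refine (Real.pow_arith_mean_le_arith_mean_pow_of_even _ _ _ (fun i _ => hw i) hw1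
      even_two).trans (Finset.sum_le_sum fun i _ => ?_)
    rw [mul_comm 2, mul_assoc]
    exact mul_le_mul_of_nonneg_left add_sq_le (hw i)
  refine (ENNReal.ofReal_le_ofReal (add_le_add_right h2 _)).trans ?_
  rw [← Finset.sum_add_distrib, ENNReal.ofReal_sum_of_nonneg]
  swap
  · intro i _
    have := hw i
    have : 0 ≤ ∫ y, kernelWeight K m h x y ^ 2 ∂densityMeasure I (P i) :=
      integral_nonneg fun _ => sq_nonneg _
    positivity
  refine Finset.sum_le_sum fun i _ => ?_
  have := hw i
  rw [enorm_sq_eq_ofReal, enorm_sq_eq_ofReal, ← ENNReal.ofReal_add (by positivity) (by positivity),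
    ← ENNReal.ofReal_mul (by positivity), ← ofReal_integral_eq_lintegral_ofReal,
    ← ENNReal.ofReal_mul (by positivity), ← ENNReal.ofReal_add]
  · exact mul_nonneg (sq_nonneg _) (integral_nonneg fun _ => sq_nonneg _)
  · positivity
  · refine Integrable.of_bound (hkm.pow_const 2).aestronglyMeasurable ((h⁻¹ * M) ^ 2)
      (ae_of_all _ fun y => ?_)
    rw [Real.norm_eq_abs, abs_pow]
    gcongr
    exact hkb y
  · exact ae_of_all _ fun _ => sq_nonneg _

theorem aemeasurable_lintegral_window {I : Set ℝ} {g : ℝ → ℝ≥0∞}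
    (hg : AEMeasurable g (volume.restrict I)) (h : ℝ) :
    AEMeasurable (fun x => ∫⁻ t in I ∩ Icc (x - h) (x + h), g t) (volume.restrict I) := by
  have hSm : MeasurableSet {p : ℝ × ℝ | p.1 - h ≤ p.2 ∧ p.2 ≤ p.1 + h} :=
    (measurableSet_le (measurable_fst.sub_const h) measurable_snd).inter
      (measurableSet_le measurable_snd (measurable_fst.add_const h))
  refine (AEMeasurable.lintegral_prod_right'
    ((hg.comp_snd (μ := volume.restrict I)).indicator hSm)).congr (ae_of_all _ fun x => ?_)
  beta_reduce
  rw [inter_comm I, ← Measure.restrict_restrict measurableSet_Icc,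
    ← lintegral_indicator measurableSet_Icc]
  rfl

theorem risk_kernelEstimator_le {β : ℕ} (hβ : 1 ≤ β) {M : ℝ} {K : ℝ → ℝ} (hK : IsKernel β M K)
    {I : Set ℝ} (hI : I.OrdConnected) {m h L ρ : ℝ} (hh : 0 < h)
    (hmI : ∀ x ∈ I, x + (if x < m then 1 else -1) * h ∈ I) {n : ℕ} (hn : 1 ≤ n)
    {w : Finset.Icc 1 n → ℝ} (hw : ∀ i, 0 ≤ w i) (hw1 : ∑ i, w i = 1) (hL : 0 ≤ L) {c : ℝ}
    {Δ : ℕ → ℝ} (hΔ : ∀ i, w i ≠ 0 → Δ i ≤ ρ) {P : ℕ → ℝ → ℝ}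
    (hP : P ∈ smoothFamily β L I c n Δ) :
    risk I n P (kernelEstimator w hK.measurable m h) ≤
      ENNReal.ofReal ((∑ i, w i ^ 2) * (2 * M ^ 2 / h) +
        2 * ((M * h ^ (β - 1)) ^ 2 * (4 * h ^ 2) * L ^ 2 + ρ ^ 2)) := by
  obtain ⟨hsm, hdr⟩ := hP
  have hIm := hI.measurableSet
  have hprob : ∀ i : Finset.Icc 1 n, IsProbabilityMeasure (densityMeasure I (P i)) := fun i =>
    (hsm i (Finset.mem_Icc.1 i.2)).1.density.isProbabilityMeasure
  have hPm : ∀ i ∈ Icc 1 n, AEMeasurable (P i) (volume.restrict I) := fun i hi =>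
    ((hsm i hi).1.continuousOn hβ).aemeasurable hIm
  have hnI : n ∈ Icc 1 n := ⟨hn, le_rfl⟩
  have : IsProbabilityMeasure (sampleLaw I n P) := by
    unfold sampleLaw; infer_instance
  set T := kernelEstimator w hK.measurable m h with hT
  unfold risk L2Dist
  simp_rw [eLpNorm_two_sq]
  -- Tonelli reduces the risk to pointwise mean squared errors; joint measurability of the estimator
  -- is what permits it.
  rw [lintegral_lintegral_swap]
  swap
  · refine AEMeasurable.pow_const (AEMeasurable.enorm (AEMeasurable.sub ?_ ?_)) 2
    · exact (hPm n hnI).comp_snd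
    · exact T.2.aemeasurable
  have hV : ∀ i : Finset.Icc 1 n, Measurable fun x =>
      ∫⁻ y, ENNReal.ofReal (kernelWeight K m h x y ^ 2) ∂densityMeasure I (P i) := fun i =>
    Measurable.lintegral_prod_right'
      ((hK.measurable_kernelWeight m h).pow_const 2).ennreal_ofReal
  have hbias : ∀ i : Finset.Icc 1 n, ∀ x ∈ I,
      ‖(∫ y, kernelWeight K m h x y ∂densityMeasure I (P i)) - P i x‖ₑ ≤
        ENNReal.ofReal (M * h ^ (β - 1)) *
      ∫⁻ t in I ∩ Icc (x - h) (x + h), ‖iteratedDerivWithin β (P i) I t‖ₑ := fun i x hx => by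
    have hi := Finset.mem_Icc.1 i.2
    rw [integral_densityMeasure hIm (hsm i hi).1.density (hPm i hi)]
    exact hK.enorm_bias_le hβ hI (hsm i hi).1.differentiable (hsm i hi).1.absolutelyContinuous
      hh hx (hmI x hx)
  have hdm : ∀ i : Finset.Icc 1 n, AEMeasurable (fun x => ‖P i x - P n x‖ₑ ^ 2)
      (volume.restrict I) := fun i =>
    (((hPm i (Finset.mem_Icc.1 i.2)).sub (hPm n hnI)).enorm).pow_const 2
  calc ∫⁻ x in I, (∫⁻ X, ‖P n x - T.1 X x‖ₑ ^ 2 ∂sampleLaw I n P)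
      ≤ ∫⁻ x in I, ∑ i, (ENNReal.ofReal (w i ^ 2) *
          (∫⁻ y, ENNReal.ofReal (kernelWeight K m h x y ^ 2) ∂densityMeasure I (P i)) +
        ENNReal.ofReal (2 * w i) * (‖P i x - P n x‖ₑ ^ 2 +
          (ENNReal.ofReal (M * h ^ (β - 1)) *
          ∫⁻ t in I ∩ Icc (x - h) (x + h), ‖iteratedDerivWithin β (P i) I t‖ₑ) ^ 2)) := by
        refine setLIntegral_mono' hIm fun x hx => ?_
        refine (lintegral_sq_sub_kernelEstimator_le hK hh hw hw1 hprob x).trans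
          (Finset.sum_le_sum fun i _ => ?_)
        rw [add_comm (‖P i x - P n x‖ₑ ^ 2)]
        gcongr
        exact hbias i x hx
    _ = ∑ i, (ENNReal.ofReal (w i ^ 2) *
          (∫⁻ x in I, ∫⁻ y, ENNReal.ofReal (kernelWeight K m h x y ^ 2) ∂densityMeasure I (P i)) +
        ENNReal.ofReal (2 * w i) * ((∫⁻ x in I, ‖P i x - P n x‖ₑ ^ 2) +
          ENNReal.ofReal (M * h ^ (β - 1)) ^ 2 * ∫⁻ x in I,
          (∫⁻ t in I ∩ Icc (x - h) (x + h), ‖iteratedDerivWithin β (P i) I t‖ₑ) ^ 2)) := by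
        have hW : ∀ i : Finset.Icc 1 n, AEMeasurable (fun x => (ENNReal.ofReal (M * h ^ (β - 1)) *
            ∫⁻ t in I ∩ Icc (x - h) (x + h), ‖iteratedDerivWithin β (P i) I t‖ₑ) ^ 2)
            (volume.restrict I) := fun i =>
          ((aemeasurable_lintegral_window
            (aemeasurable_iteratedDerivWithin hβ hI (P i)).enorm h).const_mul _).pow_const 2
        rw [lintegral_finsetSum']
        swap
        · exact fun i _ => ((hV i).aemeasurable.const_mul _).add
            (((hdm i).add (hW i)).const_mul _)
        refine Finset.sum_congr rfl fun i _ => ?_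
        rw [lintegral_add_left ((hV i).const_mul _), lintegral_const_mul _ (hV i),
          lintegral_const_mul' _ _ ENNReal.ofReal_ne_top, lintegral_add_left' (hdm i)]
        simp_rw [mul_pow]
        rw [lintegral_const_mul' _ _ (ENNReal.pow_ne_top ENNReal.ofReal_ne_top)]
    _ ≤ ∑ i, (ENNReal.ofReal (w i ^ 2) * ENNReal.ofReal (2 * M ^ 2 / h) +
        ENNReal.ofReal (2 * w i) * (ENNReal.ofReal (ρ ^ 2) +
          ENNReal.ofReal (M * h ^ (β - 1)) ^ 2 * (ENNReal.ofReal (4 * h ^ 2) *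
            ENNReal.ofReal L ^ 2))) := by
        refine Finset.sum_le_sum fun i _ => ?_
        have hi := Finset.mem_Icc.1 i.2
        refine add_le_add ?_ ?_
        · gcongr
          exact hK.lintegral_kernelWeight_sq_le hh I _
        -- The drift bound `ρ` is available only for observations that get a nonzero weight.
        · by_cases hwi : w i = 0
          · simp [hwi]
          have hΔ0 := hdr.regular.nonneg i hi
          refine mul_le_mul' le_rfl (add_le_add ?_ (mul_le_mul' le_rfl ?_))
          · rw [← eLpNorm_two_sq]
            refine (pow_le_pow_left' (hdr.drift_le i hi) 2).trans ?_
            rw [← ENNReal.ofReal_pow hΔ0]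
            exact ENNReal.ofReal_le_ofReal (pow_le_pow_left₀ hΔ0 (hΔ i hwi) 2)
          · refine (lintegral_sq_lintegral_window_le
              (aemeasurable_iteratedDerivWithin hβ hI _).enorm hh).trans ?_
            rw [← eLpNorm_two_sq]
            gcongr
            exact (hsm i hi).2
    _ = _ := by
        have hM := hK.nonneg
        have e : ∀ i, (ENNReal.ofReal (w i ^ 2) * ENNReal.ofReal (2 * M ^ 2 / h) +
            ENNReal.ofReal (2 * w i) * (ENNReal.ofReal (ρ ^ 2) +
            ENNReal.ofReal (M * h ^ (β - 1)) ^ 2 * (ENNReal.ofReal (4 * h ^ 2) *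
            ENNReal.ofReal L ^ 2))) = ENNReal.ofReal (w i ^ 2 * (2 * M ^ 2 / h) +
            2 * w i * (ρ ^ 2 + (M * h ^ (β - 1)) ^ 2 * (4 * h ^ 2 * L ^ 2))) := fun i => by
          have := hw i
          rw [ENNReal.ofReal_add, ENNReal.ofReal_mul (p := w i ^ 2), ENNReal.ofReal_mul (p := 2 * w i),
            ENNReal.ofReal_add, ENNReal.ofReal_mul (p := (M * h ^ (β - 1)) ^ 2),
            ENNReal.ofReal_mul (p := 4 * h ^ 2), ENNReal.ofReal_pow (p := L),
            ENNReal.ofReal_pow (p := M * h ^ (β - 1))] <;> positivity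
        simp_rw [e]
        rw [← ENNReal.ofReal_sum_of_nonneg fun i _ => by have := hw i; positivity]
        congr 1
        rw [Finset.sum_add_distrib, ← Finset.sum_mul, ← Finset.sum_mul, ← Finset.mul_sum, hw1]
        ring

/-! ### The upper bound -/

theorem exists_minimaxRisk_le {β : ℕ} (hβ : 1 ≤ β) {I : Set ℝ} (hI : I.OrdConnected)
    (hI' : (interior I).Nonempty) {L : ℝ} (hL : 0 < L) (c : ℝ) :
    ∃ C : ℝ, 0 < C ∧ ∀ (n : ℕ) (Δ : ℕ → ℝ) (r : ℕ), IsRegularSequence c n Δ →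
      r ∈ admissibleWindows β n Δ →
        minimaxRisk β L I c n Δ ≤
          ENNReal.ofReal (C * (r : ℝ) ^ (-(2 * (β : ℝ)) / (2 * β + 1))) := by
  obtain ⟨M, K, hK⟩ := exists_isKernel β hβ
  obtain ⟨m, hm⟩ := hI'
  obtain ⟨h₀, hh₀, hball⟩ := Metric.nhds_basis_closedBall.mem_iff.1 (mem_interior_iff_mem_nhds.1 hm)
  have hMm := hK.nonneg
  refine ⟨2 * M ^ 2 / h₀ + 2 * ((M * h₀ ^ (β - 1)) ^ 2 * (4 * h₀ ^ 2) * L ^ 2 + 1), by positivity,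
    fun n Δ r hreg hr => ?_⟩
  obtain ⟨⟨hr1, hrn⟩, hrΔ⟩ := hr
  have hr0 : (1 : ℝ) ≤ r := by exact_mod_cast hr1
  have hβ0 : (0 : ℝ) < 2 * β + 1 := by positivity
  -- `q` is the bandwidth up to the factor `h₀`. It satisfies `1 / r = q ^ (2β + 1)`, and the
  -- admissibility threshold is `q ^ β`.
  set q : ℝ := (r : ℝ) ^ (-(1 : ℝ) / (2 * β + 1)) with hq
  have hq0 : 0 < q := by positivity
  have hq1 : q ≤ 1 := Real.rpow_le_one_of_one_le_of_nonpos hr0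
    (div_nonpos_of_nonpos_of_nonneg (by norm_num) hβ0.le)
  have hqβ : (r : ℝ) ^ (-(2 * (β : ℝ)) / (2 * β + 1)) = q ^ (2 * β) := by
    rw [hq, ← Real.rpow_natCast, ← Real.rpow_mul (by positivity)]
    congr 1; push_cast; ring
  have hρ : (1 / (r : ℝ)) ^ ((β : ℝ) / (2 * β + 1)) = q ^ β := by
    rw [hq, ← Real.rpow_natCast (_ ^ _), ← Real.rpow_mul (by positivity), one_div,
      Real.inv_rpow (by positivity), ← Real.rpow_neg (by positivity)]
    congr 1; ring
  have hrq : (r : ℝ)⁻¹ = q ^ (2 * β) * q := by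
    rw [← pow_succ, hq, ← Real.rpow_natCast, ← Real.rpow_mul (by positivity), ← Real.rpow_neg_one]
    congr 1; push_cast; field_simp
  have hh : 0 < h₀ * q := by positivity
  -- `I` contains the points within `h₀` of `m`, so a point left of `m` has room `h₀ * q ≤ h₀` to
  -- its right, and any other point of `I` has it to its left.
  have hmI : ∀ x ∈ I, x + (if x < m then 1 else -1) * (h₀ * q) ∈ I := fun x hx => by
    have hle : h₀ * q ≤ h₀ := mul_le_of_le_one_right hh₀.le hq1
    rw [Real.closedBall_eq_Icc] at hball
    split_ifs with hxm
    · exact hI.out hx (hball ⟨by linarith, le_rfl⟩) ⟨by linarith, by linarith⟩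
    · exact hI.out (hball ⟨le_rfl, by linarith⟩) hx ⟨by linarith, by linarith⟩
  set w : Finset.Icc 1 n → ℝ := fun i => if n - r + 1 ≤ (i : ℕ) then (r : ℝ)⁻¹ else 0 with hw
  have hsum : ∀ a : ℝ, ∑ i : Finset.Icc 1 n, (if n - r + 1 ≤ (i : ℕ) then a else 0) = r * a := by
    intro a
    rw [Finset.sum_coe_sort (Finset.Icc 1 n) (fun i => if n - r + 1 ≤ i then a else 0),
      ← Finset.sum_filter, Finset.sum_const, nsmul_eq_mul]
    congr 2
    have : (Finset.Icc 1 n).filter (fun i => n - r + 1 ≤ i) = Finset.Icc (n - r + 1) n := by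
      ext i; simp only [Finset.mem_filter, Finset.mem_Icc]; omega
    rw [this, Nat.card_Icc]; omega
  have hrr : (r : ℝ) * (r : ℝ)⁻¹ = 1 := mul_inv_cancel₀ (by positivity)
  have hw2 : ∑ i, w i ^ 2 = (r : ℝ)⁻¹ := by
    simp only [hw, ite_pow, ne_eq, OfNat.ofNat_ne_zero, not_false_eq_true, zero_pow]
    rw [hsum, pow_two, ← mul_assoc, hrr, one_mul]
  refine iInf_le_of_le (kernelEstimator w hK.measurable m (h₀ * q)) (iSup₂_le fun P hP => ?_)
  refine (risk_kernelEstimator_le hβ hK hI hh hmI (hr1.trans hrn) (ρ := q ^ β)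
    (fun i => ?_) ?_ hL.le (fun i hi => ?_) hP).trans (ENNReal.ofReal_le_ofReal ?_)
  · simp only [hw]; split_ifs <;> positivity
  · exact (hsum _).trans hrr
  · have hi' : n - r + 1 ≤ (i : ℕ) := by
      by_contra hc
      exact hi (if_neg hc)
    have hi2 := Finset.mem_Icc.1 i.2
    rw [← hρ]
    exact (hreg.antitone (a := n - r + 1) ⟨by omega, by omega⟩ hi2 hi').trans hrΔ
  -- Variance, squared bias and squared drift bound are now all exact multiples of `q ^ (2β)`.
  · rw [hw2, hrq, hqβ]
    apply le_of_eq
    obtain ⟨b, rfl⟩ : ∃ b, β = b + 1 := ⟨β - 1, by omega⟩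
    simp only [Nat.add_sub_cancel]
    field_simp
    ring

/-! ### Product laws and Le Cam's two-point inequality -/

theorem lintegral_pi_prod {ι : Type*} [Fintype ι] {Ω : ι → Type*} [∀ i, MeasurableSpace (Ω i)]
    {μ : ∀ i, Measure (Ω i)} [∀ i, IsProbabilityMeasure (μ i)] {f : ∀ i, Ω i → ℝ≥0∞}
    (hf : ∀ i, Measurable (f i)) :
    ∫⁻ x, ∏ i, f i (x i) ∂Measure.pi μ = ∏ i, ∫⁻ y, f i y ∂μ i := by
  refine (ProbabilityTheory.lintegral_prod_eq_prod_lintegral_of_indepFun Finset.univ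
    (fun i (x : ∀ i, Ω i) => f i (x i)) (ProbabilityTheory.iIndepFun_pi fun i => (hf i).aemeasurable)
    fun i => (hf i).comp (measurable_pi_apply i)).trans ?_
  refine Finset.prod_congr rfl fun i _ => ?_
  exact (measurePreserving_eval μ i).lintegral_comp (hf i)

theorem pi_withDensity {ι : Type*} [Fintype ι] {Ω : ι → Type*} [∀ i, MeasurableSpace (Ω i)]
    {μ : ∀ i, Measure (Ω i)} [∀ i, IsProbabilityMeasure (μ i)] {f : ∀ i, Ω i → ℝ≥0∞}
    (hf : ∀ i, Measurable (f i)) [∀ i, IsProbabilityMeasure ((μ i).withDensity (f i))] :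
    Measure.pi (fun i => (μ i).withDensity (f i)) =
      (Measure.pi μ).withDensity fun x => ∏ i, f i (x i) := by
  refine Measure.pi_eq fun s hs => ?_
  rw [withDensity_apply _ (MeasurableSet.univ_pi hs), ← lintegral_indicator (MeasurableSet.univ_pi hs)]
  have e : ((univ.pi s).indicator fun x => ∏ i, f i (x i)) =
      fun x => ∏ i, (s i).indicator (f i) (x i) := by
    funext x
    by_cases hx : x ∈ univ.pi s
    · rw [indicator_of_mem hx]
      exact Finset.prod_congr rfl fun i _ => (indicator_of_mem (hx i (mem_univ i)) _).symm
    · rw [indicator_of_notMem hx]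
      simp only [mem_univ_pi, not_forall] at hx
      obtain ⟨i, hi⟩ := hx
      exact (Finset.prod_eq_zero (Finset.mem_univ i) (indicator_of_notMem hi _)).symm
  rw [e, lintegral_pi_prod fun i => (hf i).indicator (hs i)]
  refine Finset.prod_congr rfl fun i _ => ?_
  rw [withDensity_apply _ (hs i), lintegral_indicator (hs i)]

/-- Le Cam's two-point bound in terms of the Hellinger affinity of the densities `s ^ 2`
and `t ^ 2`. -/
theorem mul_sq_affinity_le {α : Type*} [MeasurableSpace α] {μ : Measure α} {s t A B : α → ℝ≥0∞}
    (hs : Measurable s) (ht : Measurable t) (hA : Measurable A)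
    (hs1 : ∫⁻ x, s x ^ 2 ∂μ ≤ 1) (ht1 : ∫⁻ x, t x ^ 2 ∂μ ≤ 1) {d : ℝ≥0∞}
    (hd : ∀ x, d ≤ A x + B x) :
    d * (∫⁻ x, s x * t x ∂μ) ^ 2 ≤ 2 * ((∫⁻ x, A x * s x ^ 2 ∂μ) + ∫⁻ x, B x * t x ^ 2 ∂μ) := by
  have hmin : Measurable fun x => min (s x) (t x) := hs.min ht
  have hmax : Measurable fun x => max (s x) (t x) := hs.max ht
  -- Cauchy–Schwarz for `s t = min(s, t) max(s, t)`. The `max` factor costs at most 2, and `min ^ 2`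
  -- lies below both densities, so it can be weighed against either loss.
  have h1 : (∫⁻ x, s x * t x ∂μ) ^ 2 ≤
      (∫⁻ x, min (s x) (t x) ^ 2 ∂μ) * ∫⁻ x, max (s x) (t x) ^ 2 ∂μ := by
    refine le_trans (le_of_eq ?_) (sq_lintegral_mul_le hmin.aemeasurable hmax.aemeasurable)
    simp_rw [min_mul_max]
  have h2 : ∫⁻ x, max (s x) (t x) ^ 2 ∂μ ≤ 2 := by
    calc ∫⁻ x, max (s x) (t x) ^ 2 ∂μ ≤ ∫⁻ x, (s x ^ 2 + t x ^ 2) ∂μ := by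
          refine lintegral_mono fun x => ?_
          rcases max_choice (s x) (t x) with h | h <;> simp [h]
      _ = (∫⁻ x, s x ^ 2 ∂μ) + ∫⁻ x, t x ^ 2 ∂μ := lintegral_add_left (hs.pow_const 2) _
      _ ≤ 1 + 1 := add_le_add hs1 ht1
      _ = 2 := one_add_one_eq_two
  have h3 : d * ∫⁻ x, min (s x) (t x) ^ 2 ∂μ ≤
      (∫⁻ x, A x * s x ^ 2 ∂μ) + ∫⁻ x, B x * t x ^ 2 ∂μ := by
    rw [← lintegral_add_left (f := fun x => A x * s x ^ 2) (hA.mul (hs.pow_const 2)), ← lintegral_const_mul _ (hmin.pow_const 2)]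
    refine lintegral_mono fun x => ?_
    calc d * min (s x) (t x) ^ 2 ≤ (A x + B x) * min (s x) (t x) ^ 2 := by gcongr; exact hd x
      _ ≤ _ := by
        rw [add_mul]
        gcongr
        · exact min_le_left _ _
        · exact min_le_right _ _
  calc d * (∫⁻ x, s x * t x ∂μ) ^ 2
      ≤ d * ((∫⁻ x, min (s x) (t x) ^ 2 ∂μ) * 2) := by gcongr; exact h1.trans (by gcongr)
    _ = 2 * (d * ∫⁻ x, min (s x) (t x) ^ 2 ∂μ) := by ring
    _ ≤ _ := by gcongr

theorem ofReal_integral_le_lintegral {α : Type*} [MeasurableSpace α] {μ : Measure α} {f : α → ℝ}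
    (hf : Integrable f μ) : ENNReal.ofReal (∫ x, f x ∂μ) ≤ ∫⁻ x, ENNReal.ofReal (f x) ∂μ := by
  calc ENNReal.ofReal (∫ x, f x ∂μ) ≤ ENNReal.ofReal (∫ x, max (f x) 0 ∂μ) :=
        ENNReal.ofReal_le_ofReal (integral_mono hf hf.pos_part fun x => le_max_left _ _)
    _ = ∫⁻ x, ENNReal.ofReal (max (f x) 0) ∂μ :=
        ofReal_integral_eq_lintegral_ofReal hf.pos_part (ae_of_all _ fun x => le_max_right _ _)
    _ = _ := by simp

/-- With `u` and `v` the two roots, `u v = (u² + v² - (u - v)²) / 2`. Moreover `|u - v| ≤ |a - b|`,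
since `a - b = (u - v)(u + v)` and `u + v ≥ 1`. The error is quadratic, so mean-zero perturbations
cost only their squared norm. -/
theorem sqrt_mul_sqrt_ge {a b : ℝ} (ha : -1 / 2 ≤ a) (hb : -1 / 2 ≤ b) :
    1 + (a + b) / 2 - (a - b) ^ 2 / 2 ≤ √(1 + a) * √(1 + b) := by
  have h1 := Real.sq_sqrt (show (0 : ℝ) ≤ 1 + a by linarith)
  have h2 := Real.sq_sqrt (show (0 : ℝ) ≤ 1 + b by linarith)
  set u := √(1 + a)
  set v := √(1 + b)
  have hu : 0 ≤ u := Real.sqrt_nonneg _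
  have hv : 0 ≤ v := Real.sqrt_nonneg _
  have h3 : (a - b) ^ 2 = (u - v) ^ 2 * (u + v) ^ 2 := by
    rw [← mul_pow]; congr 1; linarith [h1, h2, sq_sub_sq u v]
  have h4 : 1 ≤ (u + v) ^ 2 := by nlinarith [mul_nonneg hu hv]
  have h5 : (u - v) ^ 2 ≤ (a - b) ^ 2 := by
    rw [h3]; exact le_mul_of_one_le_right (sq_nonneg _) h4
  nlinarith

/-! ### The hypercube of perturbations and Assouad's method -/

/-- Perturbations `f j` of a density `P₀` over `I` that live on disjoint cells `J j`, on which
`P₀` has the constant value `κ`, keep the total mass and have squared `L₂` norm `D`. -/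
structure IsPerturbation {N : ℕ} (I : Set ℝ) (P₀ : ℝ → ℝ) (κ D : ℝ) (J : Fin N → Set ℝ)
    (f : Fin N → ℝ → ℝ) : Prop where
  density : IsDensity I P₀
  measurable_base : Measurable P₀
  nonneg_base : ∀ x, 0 ≤ P₀ x
  pos : 0 < κ
  measurableSet : ∀ j, MeasurableSet (J j)
  subset : ∀ j, J j ⊆ I
  disjoint : Pairwise fun i j => Disjoint (J i) (J j)
  base_eq : ∀ j, ∀ x ∈ J j, P₀ x = κ
  measurable : ∀ j, Measurable (f j)
  eq_zero : ∀ j, ∀ x ∉ J j, f j x = 0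
  abs_le : ∀ j x, |f j x| ≤ κ / 2
  integrable : ∀ j, Integrable (f j)
  integral_eq_zero : ∀ j, ∫ x, f j x = 0
  integral_sq : ∀ j, ∫ x, f j x ^ 2 = D

/-- The perturbation at the vertex `v` of the hypercube. -/
noncomputable def vertexSum {N : ℕ} (f : Fin N → ℝ → ℝ) (v : Fin N → Bool) (x : ℝ) : ℝ :=
  ∑ j, if v j then f j x else 0

/-- The components at the vertex `v`: the last `r` of `n` are perturbed. -/
noncomputable def vertexFamily {N : ℕ} (P₀ : ℝ → ℝ) (f : Fin N → ℝ → ℝ) (n r : ℕ) (v : Fin N → Bool) (i : ℕ)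
    (x : ℝ) : ℝ :=
  P₀ x + if n - r < i then vertexSum f v x else 0

namespace IsPerturbation

variable {N : ℕ} {I : Set ℝ} {P₀ : ℝ → ℝ} {κ D : ℝ} {J : Fin N → Set ℝ} {f : Fin N → ℝ → ℝ}

theorem measurable_vertexSum (h : IsPerturbation I P₀ κ D J f) (v : Fin N → Bool) :
    Measurable (vertexSum f v) := by
  refine Finset.measurable_sum _ fun j _ => ?_
  split_ifs
  · exact h.measurable j
  · exact measurable_const

theorem vertexSum_of_mem (h : IsPerturbation I P₀ κ D J f) (v : Fin N → Bool) {j : Fin N} {x : ℝ}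
    (hx : x ∈ J j) : vertexSum f v x = if v j then f j x else 0 := by
  refine Finset.sum_eq_single j (fun i _ hij => ?_) (fun hj => absurd (Finset.mem_univ j) hj)
  rw [h.eq_zero i x (Set.disjoint_left.1 (h.disjoint hij.symm) hx), ite_self]

theorem vertexSum_of_notMem (h : IsPerturbation I P₀ κ D J f) (v : Fin N → Bool) {x : ℝ}
    (hx : ∀ j, x ∉ J j) : vertexSum f v x = 0 :=
  Finset.sum_eq_zero fun j _ => by rw [h.eq_zero j x (hx j), ite_self]

theorem abs_vertexSum_le (h : IsPerturbation I P₀ κ D J f) (v : Fin N → Bool) (x : ℝ) :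
    |vertexSum f v x| ≤ κ / 2 := by
  have hκ := h.pos
  by_cases hx : ∃ j, x ∈ J j
  · obtain ⟨j, hj⟩ := hx
    rw [h.vertexSum_of_mem v hj]
    split_ifs
    · exact h.abs_le j x
    · simp; positivity
  · push Not at hx
    rw [h.vertexSum_of_notMem v hx]; simp; positivity

/-- The perturbation lives where `P₀ = κ`. Hence `P₀ + g = P₀ (1 + g / κ)` everywhere, a likelihood
ratio that never divides by `P₀`. -/
theorem base_mul_vertexSum (h : IsPerturbation I P₀ κ D J f) (v : Fin N → Bool) (x : ℝ) :
    P₀ x * vertexSum f v x = κ * vertexSum f v x := by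
  by_cases hx : ∃ j, x ∈ J j
  · obtain ⟨j, hj⟩ := hx
    rw [h.base_eq j x hj]
  · push Not at hx
    rw [h.vertexSum_of_notMem v hx]; simp

theorem integrable_vertexSum (h : IsPerturbation I P₀ κ D J f) (v : Fin N → Bool) :
    Integrable (vertexSum f v) := by
  refine integrable_finsetSum _ fun j _ => ?_
  split_ifs
  · exact h.integrable j
  · exact integrable_zero _ _ _

theorem integral_vertexSum (h : IsPerturbation I P₀ κ D J f) (v : Fin N → Bool) :
    ∫ x, vertexSum f v x = 0 := by
  unfold vertexSum
  rw [integral_finsetSum]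
  · refine Finset.sum_eq_zero fun j _ => ?_
    split_ifs
    · exact h.integral_eq_zero j
    · simp
  · intro j _
    split_ifs
    · exact h.integrable j
    · exact integrable_zero _ _ _

theorem vertexSum_flip_sub_sq (h : IsPerturbation I P₀ κ D J f) (v : Fin N → Bool) (j : Fin N)
    (x : ℝ) : (vertexSum f v x - vertexSum f (Function.update v j (!v j)) x) ^ 2 = f j x ^ 2 := by
  by_cases hx : ∃ i, x ∈ J i
  · obtain ⟨i, hi⟩ := hx
    rw [h.vertexSum_of_mem _ hi, h.vertexSum_of_mem _ hi]
    by_cases hij : i = j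
    · subst hij
      rw [Function.update_self]
      cases v i <;> simp
    · rw [Function.update_of_ne hij, sub_self,
        h.eq_zero j x (Set.disjoint_left.1 (h.disjoint hij) hi)]
  · push Not at hx
    rw [h.vertexSum_of_notMem _ hx, h.vertexSum_of_notMem _ hx, h.eq_zero j x (hx j), sub_self]

/-- The square root of the likelihood ratio of the vertex `v` and the base density. -/
noncomputable def rootRatio (κ : ℝ) (f : Fin N → ℝ → ℝ) (v : Fin N → Bool) (x : ℝ) : ℝ≥0∞ :=
  ENNReal.ofReal √(1 + vertexSum f v x / κ)

theorem neg_half_le (h : IsPerturbation I P₀ κ D J f) (v : Fin N → Bool) (x : ℝ) :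
    -1 / 2 ≤ vertexSum f v x / κ := by
  rw [le_div_iff₀ h.pos]
  have := (_root_.abs_le.1 (h.abs_vertexSum_le v x)).1
  linarith

theorem measurable_rootRatio (h : IsPerturbation I P₀ κ D J f) (v : Fin N → Bool) :
    Measurable (rootRatio κ f v) :=
  (((h.measurable_vertexSum v).div_const κ).const_add 1).sqrt.ennreal_ofReal

theorem rootRatio_sq (h : IsPerturbation I P₀ κ D J f) (v : Fin N → Bool) (x : ℝ) :
    rootRatio κ f v x ^ 2 = ENNReal.ofReal (1 + vertexSum f v x / κ) := by
  have := h.neg_half_le v x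
  rw [rootRatio, ← ENNReal.ofReal_pow (Real.sqrt_nonneg _), Real.sq_sqrt (by linarith)]

theorem densityMeasure_add_vertexSum (h : IsPerturbation I P₀ κ D J f) (v : Fin N → Bool) :
    densityMeasure I (fun x => P₀ x + vertexSum f v x) =
      (densityMeasure I P₀).withDensity fun x => rootRatio κ f v x ^ 2 := by
  rw [densityMeasure, densityMeasure, ← withDensity_mul _ h.measurable_base.ennreal_ofReal
    ((h.measurable_rootRatio v).pow_const 2)]
  congr 1
  funext x
  have hκ := h.pos
  rw [Pi.mul_apply, h.rootRatio_sq, ← ENNReal.ofReal_mul (h.nonneg_base x), mul_add, mul_one,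
    mul_div_assoc', h.base_mul_vertexSum, mul_div_cancel_left₀ _ hκ.ne']

theorem base_add_nonneg (h : IsPerturbation I P₀ κ D J f) (v : Fin N → Bool) (x : ℝ) :
    0 ≤ P₀ x + vertexSum f v x := by
  have hκ := h.pos
  by_cases hx : ∃ j, x ∈ J j
  · obtain ⟨j, hj⟩ := hx
    rw [h.base_eq j x hj]
    linarith [(_root_.abs_le.1 (h.abs_vertexSum_le v x)).1]
  · push Not at hx
    rw [h.vertexSum_of_notMem v hx, add_zero]
    exact h.nonneg_base x

theorem setIntegral_vertexSum (h : IsPerturbation I P₀ κ D J f) (v : Fin N → Bool) :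
    ∫ x in I, vertexSum f v x = 0 := by
  rw [setIntegral_eq_integral_of_forall_compl_eq_zero, h.integral_vertexSum]
  intro x hx
  exact h.vertexSum_of_notMem v fun j hj => hx (h.subset j hj)

theorem integrableOn_base (h : IsPerturbation I P₀ κ D J f) : IntegrableOn P₀ I := by
  refine ⟨h.measurable_base.aestronglyMeasurable, ?_⟩
  rw [hasFiniteIntegral_iff_ofReal (ae_of_all _ h.nonneg_base), h.density.integral_eq_one]
  exact ENNReal.one_lt_top

theorem integral_base (h : IsPerturbation I P₀ κ D J f) : ∫ x in I, P₀ x = 1 := by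
  rw [integral_eq_lintegral_of_nonneg_ae (ae_of_all _ h.nonneg_base)
    h.measurable_base.aestronglyMeasurable, h.density.integral_eq_one, ENNReal.toReal_one]

theorem isDensity_add (h : IsPerturbation I P₀ κ D J f) (v : Fin N → Bool) :
    IsDensity I fun x => P₀ x + vertexSum f v x where
  nonneg x _ := h.base_add_nonneg v x
  integral_eq_one := by
    rw [← ofReal_integral_eq_lintegral_ofReal (f := fun x => P₀ x + vertexSum f v x)
      (h.integrableOn_base.add (h.integrable_vertexSum v).integrableOn)
      (ae_of_all _ (h.base_add_nonneg v)),
      integral_add h.integrableOn_base (h.integrable_vertexSum v).integrableOn, h.integral_base,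
      h.setIntegral_vertexSum, add_zero, ENNReal.ofReal_one]

theorem integrable_sq (h : IsPerturbation I P₀ κ D J f) (j : Fin N) :
    Integrable fun x => f j x ^ 2 := by
  simp_rw [pow_two]
  exact (h.integrable j).mul_bdd (h.measurable j).aestronglyMeasurable
    (ae_of_all _ fun x => h.abs_le j x)

theorem affinity_ge (h : IsPerturbation I P₀ κ D J f) (v : Fin N → Bool) (j : Fin N) :
    ENNReal.ofReal (1 - D / (2 * κ)) ≤ ∫⁻ x, rootRatio κ f v x *
      rootRatio κ f (Function.update v j (!v j)) x ∂densityMeasure I P₀ := by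
  set v' := Function.update v j (!v j)
  have hκ := h.pos
  have hm : Measurable fun x => rootRatio κ f v x * rootRatio κ f v' x :=
    (h.measurable_rootRatio v).mul (h.measurable_rootRatio v')
  rw [densityMeasure, lintegral_withDensity_eq_lintegral_mul _ h.measurable_base.ennreal_ofReal hm]
  -- `P₀` times the lower bound of `sqrt_mul_sqrt_ge`. Its linear part integrates to zero, and the
  -- quadratic part to `D / (2κ)`, as flipping one coordinate changes the sum by `± f j`.
  set F : ℝ → ℝ := fun x => P₀ x + (1 / 2) * (vertexSum f v x + vertexSum f v' x) -
    (1 / (2 * κ)) * f j x ^ 2 with hF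
  have hFx : ∀ x, ENNReal.ofReal (F x) ≤
      ((fun x => ENNReal.ofReal (P₀ x)) * fun x => rootRatio κ f v x * rootRatio κ f v' x) x := by
    intro x
    have := sqrt_mul_sqrt_ge (h.neg_half_le v x) (h.neg_half_le v' x)
    rw [Pi.mul_apply, rootRatio, rootRatio, ← ENNReal.ofReal_mul (Real.sqrt_nonneg _),
      ← ENNReal.ofReal_mul (h.nonneg_base x)]
    refine ENNReal.ofReal_le_ofReal (le_trans (le_of_eq ?_)
      (mul_le_mul_of_nonneg_left this (h.nonneg_base x)))
    have e1 := h.base_mul_vertexSum v x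
    have e2 := h.base_mul_vertexSum v' x
    simp only [hF]
    rw [← h.vertexSum_flip_sub_sq v j x]
    field_simp
    linear_combination (-κ - vertexSum f v' x + vertexSum f v x) * e1 +
      (-κ + vertexSum f v' x - vertexSum f v x) * e2
  have hi1 : IntegrableOn (fun x => P₀ x + (1 / 2) * (vertexSum f v x + vertexSum f v' x)) I :=
    h.integrableOn_base.add (((h.integrable_vertexSum v).add
      (h.integrable_vertexSum v')).const_mul _).integrableOn
  have hi2 : IntegrableOn (fun x => (1 / (2 * κ)) * f j x ^ 2) I :=
    ((h.integrable_sq j).const_mul _).integrableOn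
  have hsq : ∫ x in I, f j x ^ 2 = D := by
    rw [setIntegral_eq_integral_of_forall_compl_eq_zero, h.integral_sq]
    intro x hx
    rw [h.eq_zero j x fun hj => hx (h.subset j hj)]
    simp
  have hFint : ∫ x in I, F x = 1 - D / (2 * κ) := by
    rw [hF, integral_sub hi1 hi2, integral_add (g := fun x => (1 / 2) * (vertexSum f v x +
      vertexSum f v' x)) h.integrableOn_base
      (((h.integrable_vertexSum v).add (h.integrable_vertexSum v')).const_mul _).integrableOn,
      integral_const_mul, integral_const_mul, integral_add
      (h.integrable_vertexSum v).integrableOn (h.integrable_vertexSum v').integrableOn,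
      h.integral_base, h.setIntegral_vertexSum, h.setIntegral_vertexSum, hsq]
    ring
  rw [← hFint]
  refine le_trans ?_ (lintegral_mono hFx)
  exact ofReal_integral_le_lintegral (hi1.sub hi2)

/-- The square root of the likelihood ratio of the `i`-th component at the vertex `v`. -/
noncomputable def componentRatio (κ : ℝ) (f : Fin N → ℝ → ℝ) (n r : ℕ) (v : Fin N → Bool) (i : ℕ)
    (x : ℝ) : ℝ≥0∞ :=
  if n - r < i then rootRatio κ f v x else 1

theorem measurable_componentRatio (h : IsPerturbation I P₀ κ D J f) (n r : ℕ) (v : Fin N → Bool)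
    (i : ℕ) : Measurable (componentRatio κ f n r v i) := by
  unfold componentRatio
  split_ifs
  · exact h.measurable_rootRatio v
  · exact measurable_const

theorem densityMeasure_vertexFamily (h : IsPerturbation I P₀ κ D J f) (n r : ℕ)
    (v : Fin N → Bool) (i : ℕ) : densityMeasure I (vertexFamily P₀ f n r v i) =
      (densityMeasure I P₀).withDensity fun x => componentRatio κ f n r v i x ^ 2 := by
  by_cases hi : n - r < i
  · simp only [componentRatio, hi, if_true]
    rw [← h.densityMeasure_add_vertexSum]
    congr 1
    funext x
    simp [vertexFamily, hi]
  · have : vertexFamily P₀ f n r v i = P₀ := by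
      funext x; simp [vertexFamily, hi]
    simp [componentRatio, hi, this]

theorem isDensity_vertexFamily (h : IsPerturbation I P₀ κ D J f) (n r : ℕ)
    (v : Fin N → Bool) (i : ℕ) : IsDensity I (vertexFamily P₀ f n r v i) := by
  by_cases hi : n - r < i
  · convert h.isDensity_add v using 1
    funext x
    simp [vertexFamily, hi]
  · convert h.density using 1
    funext x
    simp [vertexFamily, hi]

theorem sampleLaw_vertexFamily (h : IsPerturbation I P₀ κ D J f) (n r : ℕ) (v : Fin N → Bool) :
    sampleLaw I n (vertexFamily P₀ f n r v) =
      (Measure.pi fun _ : Finset.Icc 1 n => densityMeasure I P₀).withDensity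
        fun X => (∏ i : Finset.Icc 1 n, componentRatio κ f n r v i (X i)) ^ 2 := by
  have := h.density.isProbabilityMeasure
  have hp : ∀ i : Finset.Icc 1 n, IsProbabilityMeasure
      ((densityMeasure I P₀).withDensity fun x => componentRatio κ f n r v i x ^ 2) := fun i => by
    rw [← h.densityMeasure_vertexFamily]
    exact (h.isDensity_vertexFamily n r v i).isProbabilityMeasure
  unfold sampleLaw
  simp_rw [h.densityMeasure_vertexFamily, ← Finset.prod_pow]
  exact pi_withDensity fun i : Finset.Icc 1 n => (h.measurable_componentRatio n r v i).pow_const 2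

theorem half_le_affinity (h : IsPerturbation I P₀ κ D J f) {n r : ℕ} (hr : 1 ≤ r) (hrn : r ≤ n)
    (hD : D ≤ κ / r) (v : Fin N → Bool) (j : Fin N) :
    ENNReal.ofReal (1 / 2) ≤ ∫⁻ X, (∏ i : Finset.Icc 1 n, componentRatio κ f n r v i (X i)) *
      (∏ i : Finset.Icc 1 n, componentRatio κ f n r (Function.update v j (!v j)) i (X i))
      ∂Measure.pi fun _ : Finset.Icc 1 n => densityMeasure I P₀ := by
  have := h.density.isProbabilityMeasure
  have hκ := h.pos
  have hr0 : (0 : ℝ) < r := by exact_mod_cast hr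
  simp_rw [← Finset.prod_mul_distrib]
  rw [lintegral_pi_prod (f := fun (i : Finset.Icc 1 n) x => componentRatio κ f n r v i x *
    componentRatio κ f n r (Function.update v j (!v j)) i x) fun i : Finset.Icc 1 n =>
    (h.measurable_componentRatio n r v i).mul (h.measurable_componentRatio n r _ i)]
  have hq : D / (2 * κ) ≤ 1 / (2 * r) := by
    rw [div_le_div_iff₀ (by positivity) (by positivity)]
    rw [le_div_iff₀ hr0] at hD
    linarith
  have hq1 : 1 / (2 * (r : ℝ)) ≤ 1 := by
    rw [div_le_one (by positivity)]
    have : (1 : ℝ) ≤ r := by exact_mod_cast hr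
    linarith
  -- The affinity is multiplicative over the components, and only the last `r` contribute a factor
  -- below one. Bernoulli's inequality gives `(1 - 1/(2r)) ^ r ≥ 1/2`.
  calc ENNReal.ofReal (1 / 2) ≤ ENNReal.ofReal ((1 - D / (2 * κ)) ^ r) := by
        apply ENNReal.ofReal_le_ofReal
        calc (1 / 2 : ℝ) = 1 + r * (-(1 / (2 * r))) := by field_simp; norm_num
          _ ≤ (1 + -(1 / (2 * r))) ^ r := one_add_mul_le_pow (by linarith) r
          _ ≤ _ := by
            apply pow_le_pow_left₀ <;> linarith
    _ = ENNReal.ofReal (1 - D / (2 * κ)) ^ r := ENNReal.ofReal_pow (by linarith) r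
    _ = ∏ i : Finset.Icc 1 n,
          if n - r < (i : ℕ) then ENNReal.ofReal (1 - D / (2 * κ)) else 1 := by
        rw [Finset.prod_coe_sort (Finset.Icc 1 n)
          (fun i => if n - r < i then ENNReal.ofReal (1 - D / (2 * κ)) else 1),
          ← Finset.prod_filter, Finset.prod_const]
        congr 1
        have : (Finset.Icc 1 n).filter (fun i => n - r < i) = Finset.Ioc (n - r) n := by
          ext i; simp only [Finset.mem_filter, Finset.mem_Icc, Finset.mem_Ioc]; omega
        rw [this, Nat.card_Ioc]; omega
    _ ≤ _ := by
        refine Finset.prod_le_prod' fun i _ => ?_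
        unfold componentRatio
        split_ifs
        · exact h.affinity_ge v j
        · simp

theorem measurable_vertexFamily (h : IsPerturbation I P₀ κ D J f) (n r : ℕ) (v : Fin N → Bool)
    (i : ℕ) : Measurable (vertexFamily P₀ f n r v i) := by
  refine h.measurable_base.add ?_
  split_ifs
  · exact h.measurable_vertexSum v
  · exact measurable_const

/-- The integrated squared error of `g` as an estimate of `p` over the cell `S`. -/
noncomputable def cellLoss (S : Set ℝ) (p g : ℝ → ℝ) : ℝ≥0∞ := ∫⁻ x in S, ‖p x - g x‖ₑ ^ 2

theorem measurable_cellLoss {n : ℕ} {p : ℝ → ℝ} (hp : Measurable p) (T : Estimator n) (S : Set ℝ) :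
    Measurable fun X => cellLoss S p (T.1 X) :=
  Measurable.lintegral_prod_right' (f := fun q : (Finset.Icc 1 n → ℝ) × ℝ =>
    ‖p q.2 - T.1 q.1 q.2‖ₑ ^ 2) ((((hp.comp measurable_snd).sub T.2).enorm).pow_const 2)

/-- By the parallelogram law `(p - g)² + (p' - g)² ≥ (p - p')² / 2`, and on this cell the two
vertices differ by `± f j`. -/
theorem half_le_cellLoss_add (h : IsPerturbation I P₀ κ D J f) {n r : ℕ} (hr : 1 ≤ r) (hrn : r ≤ n)
    (v : Fin N → Bool) (j : Fin N) {g : ℝ → ℝ} (hg : Measurable g) :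
    ENNReal.ofReal (D / 2) ≤ cellLoss (J j) (vertexFamily P₀ f n r v n) g +
      cellLoss (J j) (vertexFamily P₀ f n r (Function.update v j (!v j)) n) g := by
  have hn : n - r < n := by omega
  have hD : D / 2 = ∫ x in J j, f j x ^ 2 / 2 := by
    rw [integral_div, setIntegral_eq_integral_of_forall_compl_eq_zero, h.integral_sq]
    intro x hx
    rw [h.eq_zero j x hx]; simp
  rw [hD, cellLoss, cellLoss, ← lintegral_add_left
    (f := fun x => ‖vertexFamily P₀ f n r v n x - g x‖ₑ ^ 2) ((((h.measurable_vertexFamily n r v n).sub hg).enorm).pow_const 2)]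
  refine (ofReal_integral_le_lintegral ((h.integrable_sq j).div_const 2).integrableOn).trans
    (lintegral_mono fun x => ?_)
  rw [enorm_sq_eq_ofReal, enorm_sq_eq_ofReal, ← ENNReal.ofReal_add (sq_nonneg _) (sq_nonneg _)]
  apply ENNReal.ofReal_le_ofReal
  rw [← h.vertexSum_flip_sub_sq v j x]
  simp only [vertexFamily, hn, if_true]
  nlinarith [sq_nonneg (P₀ x + vertexSum f v x - g x +
    (P₀ x + vertexSum f (Function.update v j (!v j)) x - g x))]

/-- The risk of `T` over the cell `S` at the vertex `v`. -/
noncomputable def cellRisk (I : Set ℝ) (P₀ : ℝ → ℝ) (f : Fin N → ℝ → ℝ) {n : ℕ} (r : ℕ)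
    (T : Estimator n) (S : Set ℝ) (v : Fin N → Bool) : ℝ≥0∞ :=
  ∫⁻ X, cellLoss S (vertexFamily P₀ f n r v n) (T.1 X) ∂sampleLaw I n (vertexFamily P₀ f n r v)

theorem le_pair_cellRisk (h : IsPerturbation I P₀ κ D J f) {n r : ℕ} (hr : 1 ≤ r) (hrn : r ≤ n)
    (hD : D ≤ κ / r) (hD0 : 0 ≤ D) (v : Fin N → Bool) (j : Fin N) (T : Estimator n) :
    ENNReal.ofReal (D / 16) ≤ cellRisk I P₀ f r T (J j) v +
      cellRisk I P₀ f r T (J j) (Function.update v j (!v j)) := by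
  have hm : ∀ v : Fin N → Bool, Measurable fun X : Finset.Icc 1 n → ℝ =>
      ∏ i : Finset.Icc 1 n, componentRatio κ f n r v i (X i) := fun v =>
    Finset.measurable_prod _ fun i _ =>
      (h.measurable_componentRatio n r v i).comp (measurable_pi_apply i)
  have hA : ∀ v : Fin N → Bool, Measurable fun X =>
      cellLoss (J j) (vertexFamily P₀ f n r v n) (T.1 X) := fun v =>
    measurable_cellLoss (h.measurable_vertexFamily n r v n) T (J j)
  have hone : ∀ v : Fin N → Bool, ∫⁻ X : Finset.Icc 1 n → ℝ,
      (∏ i : Finset.Icc 1 n, componentRatio κ f n r v i (X i)) ^ 2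
      ∂(Measure.pi fun _ : Finset.Icc 1 n => densityMeasure I P₀) ≤ 1 := fun v => by
    have hp : ∀ i : Finset.Icc 1 n, IsProbabilityMeasure
        (densityMeasure I (vertexFamily P₀ f n r v i)) := fun i =>
      (h.isDensity_vertexFamily n r v i).isProbabilityMeasure
    have : sampleLaw I n (vertexFamily P₀ f n r v) univ = 1 := by
      unfold sampleLaw; exact measure_univ
    rw [h.sampleLaw_vertexFamily, withDensity_apply _ MeasurableSet.univ,
      Measure.restrict_univ] at this
    exact this.le
  -- Separation `D / 2` times squared affinity `1 / 4`, halved for the factor 2 in Le Cam's bound,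
  -- makes `D / 16`.
  have key := mul_sq_affinity_le (hm v) (hm (Function.update v j (!v j))) (hA v) (hone _) (hone _)
    fun X => h.half_le_cellLoss_add hr hrn v j
      (g := T.1 X) (T.2.comp measurable_prodMk_left)
  have hrisk : ∀ v : Fin N → Bool, cellRisk I P₀ f r T (J j) v =
      ∫⁻ X, cellLoss (J j) (vertexFamily P₀ f n r v n) (T.1 X) *
        (∏ i : Finset.Icc 1 n, componentRatio κ f n r v i (X i)) ^ 2
        ∂(Measure.pi fun _ : Finset.Icc 1 n => densityMeasure I P₀) := fun v => by
    rw [cellRisk, h.sampleLaw_vertexFamily,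
      lintegral_withDensity_eq_lintegral_mul _ ((hm v).pow_const 2) (hA v)]
    refine lintegral_congr fun X => ?_
    rw [Pi.mul_apply, mul_comm]
  rw [hrisk, hrisk]
  refine (ENNReal.mul_le_mul_iff_right (a := 2) (by norm_num) (by norm_num)).1
    (le_trans ?_ key)
  refine le_trans (le_of_eq ?_) (mul_le_mul' le_rfl
    (pow_le_pow_left' (h.half_le_affinity hr hrn hD v j) 2))
  rw [← ENNReal.ofReal_pow (by norm_num), ← ENNReal.ofReal_mul (by positivity),
    ← ENNReal.ofReal_ofNat 2, ← ENNReal.ofReal_mul (by norm_num)]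
  congr 1; ring

/-- The cells are disjoint parts of `I`, so their losses add up to at most the full loss. -/
theorem sum_cellRisk_le_risk (h : IsPerturbation I P₀ κ D J f) {n : ℕ} (r : ℕ)
    (v : Fin N → Bool) (T : Estimator n) :
    ∑ j, cellRisk I P₀ f r T (J j) v ≤ risk I n (vertexFamily P₀ f n r v) T := by
  unfold cellRisk risk L2Dist
  rw [← lintegral_finsetSum _ fun j _ =>
    measurable_cellLoss (h.measurable_vertexFamily n r v n) T (J j)]
  refine lintegral_mono fun X => ?_
  rw [eLpNorm_two_sq]
  unfold cellLoss
  refine le_trans (le_of_eq ?_) (lintegral_mono_set (iUnion_subset h.subset))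
  rw [lintegral_iUnion h.measurableSet h.disjoint, tsum_fintype]

/-- Assouad's bound over the hypercube of perturbations. -/
theorem le_iSup_risk (h : IsPerturbation I P₀ κ D J f) {n r : ℕ} (hr : 1 ≤ r) (hrn : r ≤ n)
    (hD : D ≤ κ / r) (hD0 : 0 ≤ D) (T : Estimator n) :
    ENNReal.ofReal (N * D / 32) ≤ ⨆ v, risk I n (vertexFamily P₀ f n r v) T := by
  set R := ⨆ v, risk I n (vertexFamily P₀ f n r v) T
  have hflip : ∀ j : Fin N, ∑ v, cellRisk I P₀ f r T (J j) (Function.update v j (!v j)) =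
      ∑ v, cellRisk I P₀ f r T (J j) v := fun j => by
    have hinv : Function.Involutive fun v : Fin N → Bool => Function.update v j (!v j) := by
      intro v
      simp
    exact Equiv.sum_comp hinv.toPerm (fun v => cellRisk I P₀ f r T (J j) v)
  have hcard : (Finset.univ : Finset (Fin N → Bool)).card = 2 ^ N := by simp
  -- Sum the pair bound over all cells and vertices. A flip permutes the vertices, so each cell risk
  -- is counted twice, and each vertex contributes at most the supremum `R`.
  have h1 : (2 ^ N : ℝ≥0∞) * (N * ENNReal.ofReal (D / 16)) ≤ 2 ^ N * (2 * R) := by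
    calc (2 ^ N : ℝ≥0∞) * (N * ENNReal.ofReal (D / 16))
        = ∑ _j : Fin N, ∑ _v : Fin N → Bool, ENNReal.ofReal (D / 16) := by
          simp only [Finset.sum_const, Finset.card_univ, Fintype.card_fin, hcard, nsmul_eq_mul]
          simp
          ring
      _ ≤ ∑ j, ∑ v, (cellRisk I P₀ f r T (J j) v +
            cellRisk I P₀ f r T (J j) (Function.update v j (!v j))) :=
          Finset.sum_le_sum fun j _ => Finset.sum_le_sum fun v _ =>
            h.le_pair_cellRisk hr hrn hD hD0 v j T
      _ = 2 * ∑ v, ∑ j, cellRisk I P₀ f r T (J j) v := by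
          simp_rw [Finset.sum_add_distrib, hflip]
          rw [Finset.sum_comm, two_mul]
      _ ≤ 2 * ∑ _v : Fin N → Bool, R := by
          gcongr with v
          exact (h.sum_cellRisk_le_risk r v T).trans
            (le_iSup (fun v => risk I n (vertexFamily P₀ f n r v) T) v)
      _ = 2 ^ N * (2 * R) := by
          rw [Finset.sum_const, hcard, nsmul_eq_mul]
          push_cast
          ring
  rw [ENNReal.mul_le_mul_iff_right (by positivity) (by simp)] at h1
  refine (ENNReal.mul_le_mul_iff_right (a := 2) (by norm_num) (by norm_num)).1
    (le_trans (le_of_eq ?_) h1)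
  rw [← ENNReal.ofReal_ofNat 2, ← ENNReal.ofReal_mul (by norm_num), ← ENNReal.ofReal_natCast,
    ← ENNReal.ofReal_mul (by positivity)]
  congr 1; ring

end IsPerturbation

/-! ### Smooth building blocks: waves, base density, mother bump -/

open scoped ContDiff

/-- The function `φ` with amplitude `A` and frequency `t`, moved to the point `y`. -/
noncomputable def wave (φ : ℝ → ℝ) (A t y x : ℝ) : ℝ := A * φ (t * (x - y))

theorem contDiff_wave {φ : ℝ → ℝ} (hφ : ContDiff ℝ ∞ φ) (A t y : ℝ) :
    ContDiff ℝ ∞ (wave φ A t y) :=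
  contDiff_const.mul (hφ.comp (contDiff_const.mul (contDiff_id.sub contDiff_const)))

theorem iteratedDeriv_wave {φ : ℝ → ℝ} (hφ : ContDiff ℝ ∞ φ) (A t y : ℝ) (k : ℕ) :
    iteratedDeriv k (wave φ A t y) = wave (iteratedDeriv k φ) (A * t ^ k) t y := by
  funext x
  have h := iteratedDeriv_comp_sub_const k (fun z => A * φ (t * z)) y
  have h2 := iteratedDeriv_comp_const_mul (n := k) (hφ.of_le (by exact_mod_cast le_top)) t
  have e : wave φ A t y = fun x => (fun z => A * φ (t * z)) (x - y) := rfl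
  rw [e, h]
  beta_reduce
  rw [iteratedDeriv_const_mul_field, h2, wave]
  ring

theorem integral_wave {φ : ℝ → ℝ} (A y : ℝ) {t : ℝ} (ht : 0 < t) :
    ∫ x, wave φ A t y x = A * t⁻¹ * ∫ x, φ x := by
  unfold wave
  rw [integral_const_mul, integral_sub_right_eq_self (fun x => φ (t * x)),
    Measure.integral_comp_mul_left, abs_of_pos (inv_pos.2 ht), smul_eq_mul, mul_assoc]

theorem integral_wave_sq {φ : ℝ → ℝ} (A y : ℝ) {t : ℝ} (ht : 0 < t) :
    ∫ x, wave φ A t y x ^ 2 = A ^ 2 * t⁻¹ * ∫ x, φ x ^ 2 := by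
  rw [← integral_wave _ y ht]
  simp only [wave, mul_pow]

theorem integrable_wave {φ : ℝ → ℝ} (hφ : Integrable φ) (A y : ℝ) {t : ℝ} (ht : 0 < t) :
    Integrable (wave φ A t y) :=
  ((hφ.comp_mul_left' ht.ne').comp_sub_right y).const_mul A

theorem hasCompactSupport_iteratedDeriv {φ : ℝ → ℝ} (hφ : HasCompactSupport φ) (k : ℕ) :
    HasCompactSupport (iteratedDeriv k φ) := by
  induction k with
  | zero => rwa [iteratedDeriv_zero]
  | succ k ih => rw [iteratedDeriv_succ]; exact ih.deriv

theorem integrable_iteratedDeriv_sq {φ : ℝ → ℝ} (hφ : ContDiff ℝ ∞ φ) (hc : HasCompactSupport φ)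
    (k : ℕ) : Integrable fun x => iteratedDeriv k φ x ^ 2 := by
  have hcont : Continuous (iteratedDeriv k φ) :=
    hφ.continuous_iteratedDeriv k (by exact_mod_cast le_top)
  simp_rw [pow_two]
  exact (hcont.mul hcont).integrable_of_hasCompactSupport
    (hasCompactSupport_iteratedDeriv hc k).mul_left

theorem lintegral_enorm_wave_sq {φ : ℝ → ℝ} (hφ : Integrable fun x => φ x ^ 2) (A y : ℝ) {t : ℝ}
    (ht : 0 < t) :
    ∫⁻ x, ‖wave φ A t y x‖ₑ ^ 2 = ENNReal.ofReal (A ^ 2 * t⁻¹ * ∫ x, φ x ^ 2) := by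
  simp_rw [enorm_sq_eq_ofReal]
  rw [← integral_wave_sq A y ht, ofReal_integral_eq_lintegral_ofReal]
  · have := integrable_wave hφ (A ^ 2) y ht
    refine this.congr (ae_of_all _ fun x => ?_)
    simp [wave, mul_pow]
  · exact ae_of_all _ fun x => sq_nonneg _

theorem eLpNorm_two_le_ofReal {α : Type*} [MeasurableSpace α] {μ : Measure α} {f : α → ℝ} {a : ℝ}
    (ha : 0 ≤ a) (h : ∫⁻ x, ‖f x‖ₑ ^ 2 ∂μ ≤ ENNReal.ofReal (a ^ 2)) :
    eLpNorm f 2 μ ≤ ENNReal.ofReal a := by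
  rw [← eLpNorm_two_sq, ENNReal.ofReal_pow ha] at h
  exact (ENNReal.pow_le_pow_left_iff two_ne_zero).1 h

/-- A smooth density with a small derivative that is constant near a given point. -/
theorem exists_base_density {β : ℕ} (hβ : 1 ≤ β) {I : Set ℝ} {m h₀ : ℝ}
    (hh₀ : 0 < h₀) (hmI : Icc (m - h₀) (m + h₀) ⊆ I) {L : ℝ} (hL : 0 < L) :
    ∃ (P₀ : ℝ → ℝ) (κ : ℝ), 0 < κ ∧ ContDiff ℝ ∞ P₀ ∧ (∀ x, 0 ≤ P₀ x) ∧ IsDensity I P₀ ∧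
      (∀ x ∈ Icc (m - h₀) (m + h₀), P₀ x = κ) ∧
      eLpNorm (iteratedDeriv β P₀) 2 volume ≤ ENNReal.ofReal L := by
  let φ : ContDiffBump (0 : ℝ) := ⟨1, 2, one_pos, one_lt_two⟩
  have hφ : ContDiff ℝ ∞ φ := φ.contDiff
  have hφi : Integrable φ := φ.continuous.integrable_of_hasCompactSupport φ.hasCompactSupport
  set B := ∫ x, iteratedDeriv β φ x ^ 2 with hB
  have hB0 : 0 ≤ B := integral_nonneg fun x => sq_nonneg _
  have hlim : Filter.Tendsto (fun t : ℝ => t * (((2 * h₀)⁻¹) ^ 2 * B)) (nhdsWithin 0 (Ioi 0))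
      (nhds 0) := by
    have : Filter.Tendsto (fun t : ℝ => t * (((2 * h₀)⁻¹) ^ 2 * B)) (nhds 0) (nhds (0 * _)) :=
      Filter.tendsto_id.mul_const _
    rw [zero_mul] at this
    exact this.mono_left nhdsWithin_le_nhds
  -- A bump stretched by `1 / t`. Small `t` makes the `β`-th derivative small, and `t h₀ ≤ 1` keeps
  -- the plateau over the whole window around `m`.
  obtain ⟨t, ⟨ht1, ht2⟩, ht0 : 0 < t⟩ := (((hlim.eventually_le_const (show 0 < L ^ 2 by positivity)).and
    (nhdsWithin_le_nhds (eventually_le_nhds (b := min 1 h₀⁻¹) (by positivity)))).and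
    self_mem_nhdsWithin).exists
  have htn : t ≤ 1 := ht2.trans (min_le_left _ _)
  have hth : t * h₀ ≤ 1 := by
    have := ht2.trans (min_le_right _ _)
    rwa [← one_div, le_div_iff₀ hh₀] at this
  have hone : ∀ x ∈ Icc (m - h₀) (m + h₀), φ (t * (x - m)) = 1 := fun x hx => by
    apply φ.one_of_mem_closedBall
    rw [mem_closedBall_zero_iff, Real.norm_eq_abs, abs_mul, abs_of_pos ht0]
    have : |x - m| ≤ h₀ := by rw [abs_le]; constructor <;> linarith [hx.1, hx.2]
    exact (mul_le_mul_of_nonneg_left this ht0.le).trans hth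
  have hwi : Integrable (wave φ 1 t m) := integrable_wave hφi 1 m ht0
  set Z := ∫ x in I, wave φ 1 t m x with hZ
  -- The plateau alone bounds the normalising mass over `I` below by `2 h₀`, independently of `t`;
  -- hence the choice of `t` above could anticipate the normalisation.
  have hZle : 2 * h₀ ≤ Z := by
    calc 2 * h₀ = ∫ x in Icc (m - h₀) (m + h₀), wave φ 1 t m x := by
          rw [setIntegral_congr_fun measurableSet_Icc (g := fun _ => (1 : ℝ))]
          · simp; rw [max_eq_left] <;> linarith
          · intro x hx; simp [wave, hone x hx]
      _ ≤ Z := by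
          refine setIntegral_mono_set hwi.integrableOn (ae_of_all _ fun x => ?_)
            (LE.le.eventuallyLE hmI)
          simp [wave, φ.nonneg]
  have hZ0 : 0 < Z := by linarith
  have hP0 : ∀ x, 0 ≤ wave φ Z⁻¹ t m x := fun x =>
    mul_nonneg (inv_nonneg.2 hZ0.le) φ.nonneg
  refine ⟨wave φ Z⁻¹ t m, Z⁻¹, inv_pos.2 hZ0, contDiff_wave hφ _ _ _, hP0, ⟨fun x _ => hP0 x, ?_⟩,
    fun x hx => ?_, ?_⟩
  · rw [← ofReal_integral_eq_lintegral_ofReal (integrable_wave hφi _ _ ht0).integrableOn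
      (ae_of_all _ hP0)]
    have : ∫ x in I, wave φ Z⁻¹ t m x = Z⁻¹ * Z := by
      rw [hZ, ← integral_const_mul]
      simp [wave]
    rw [this, inv_mul_cancel₀ hZ0.ne', ENNReal.ofReal_one]
  · rw [wave, hone x hx, mul_one]
  · apply eLpNorm_two_le_ofReal hL.le
    rw [iteratedDeriv_wave hφ, lintegral_enorm_wave_sq
      (integrable_iteratedDeriv_sq hφ φ.hasCompactSupport β) _ _ ht0]
    apply ENNReal.ofReal_le_ofReal
    refine le_trans ?_ ht1
    have h1 : (t ^ β) ^ 2 * t⁻¹ ≤ t := by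
      obtain ⟨b, rfl⟩ : ∃ b, β = b + 1 := ⟨β - 1, by omega⟩
      calc (t ^ (b + 1)) ^ 2 * t⁻¹ = t * t ^ (2 * b) := by field_simp; ring
        _ ≤ t * 1 := by gcongr; exact pow_le_one₀ ht0.le htn
        _ = t := mul_one t
    calc (Z⁻¹ * t ^ β) ^ 2 * t⁻¹ * B = ((t ^ β) ^ 2 * t⁻¹) * ((Z⁻¹) ^ 2 * B) := by ring
      _ ≤ t * (((2 * h₀)⁻¹) ^ 2 * B) := by gcongr

/-- `x φ(x)` with `φ` an even bump is odd, hence has mean zero. It vanishes for `|x| ≥ 1/4`, which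
leaves a margin so that all derivatives vanish from `1/2` on. -/
theorem exists_mother_bump : ∃ ψ : ℝ → ℝ, ContDiff ℝ ∞ ψ ∧ HasCompactSupport ψ ∧
    (∀ x, |ψ x| ≤ 1) ∧ (∀ k x, 1 / 2 ≤ |x| → iteratedDeriv k ψ x = 0) ∧ ∫ x, ψ x = 0 ∧
    0 < ∫ x, ψ x ^ 2 := by
  let φ : ContDiffBump (0 : ℝ) := ⟨1 / 8, 1 / 4, by norm_num, by norm_num⟩
  have hc : HasCompactSupport fun x => x * φ x := φ.hasCompactSupport.mul_left
  have hd : ContDiff ℝ ∞ fun x => x * φ x := contDiff_id.mul φ.contDiff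
  have hz : ∀ x, 1 / 4 ≤ |x| → x * φ x = 0 := fun x hx => by
    rw [φ.zero_of_le_dist (by simpa [φ] using hx), mul_zero]
  refine ⟨fun x => x * φ x, hd, hc, fun x => ?_, fun k x hx => ?_, ?_, ?_⟩
  · beta_reduce
    by_cases hx : 1 / 4 ≤ |x|
    · rw [hz x hx]; simp
    · rw [abs_mul, abs_of_nonneg (φ.nonneg (x := x))]
      have := φ.le_one (x := x)
      exact mul_le_one₀ (by linarith) φ.nonneg this
  · have hev : (fun x => x * φ x) =ᶠ[nhds x] fun _ => (0 : ℝ) := by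
      have : ∀ᶠ z : ℝ in nhds x, 1 / 4 < |z| :=
        continuous_abs.continuousAt.eventually_const_lt (by linarith)
      filter_upwards [this] with z hz' using hz z hz'.le
    rw [hev.iteratedDeriv_eq]
    simp
  · have h := integral_neg_eq_self (fun x => x * φ x) volume
    simp only [φ.neg, neg_mul, integral_neg] at h
    linarith
  · have hcont : Continuous fun x : ℝ => (x * φ x) ^ 2 := hd.continuous.pow 2
    refine (integral_pos_iff_support_of_nonneg (fun x => sq_nonneg _) ?_).2 ?_
    · simpa using integrable_iteratedDeriv_sq hd hc 0
    · refine hcont.isOpen_support.measure_pos volume ⟨1 / 8, ?_⟩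
      have : φ (1 / 8) = 1 := φ.one_of_mem_closedBall (by
        rw [mem_closedBall_zero_iff, Real.norm_eq_abs, abs_of_pos (by norm_num)])
      rw [Function.mem_support, this]
      norm_num

theorem isSmoothDensity_of_contDiff {β : ℕ} {I : Set ℝ} (hI : I.OrdConnected)
    (hI' : (interior I).Nonempty) {P : ℝ → ℝ} (hP : ContDiff ℝ ∞ P) (hd : IsDensity I P) {L : ℝ}
    (hL : eLpNorm (iteratedDeriv β P) 2 volume ≤ ENNReal.ofReal L) :
    IsSmoothDensity β I P ∧
      eLpNorm (iteratedDerivWithin β P I) 2 (volume.restrict I) ≤ ENNReal.ofReal L := by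
  have hU : UniqueDiffOn ℝ I := uniqueDiffOn_convex hI.convex hI'
  have heq : ∀ k, EqOn (iteratedDerivWithin k P I) (iteratedDeriv k P) I := fun k x hx =>
    iteratedDerivWithin_eq_iteratedDeriv hU (hP.contDiffAt.of_le (by exact_mod_cast le_top)) hx
  have hle : eLpNorm (iteratedDerivWithin β P I) 2 (volume.restrict I) ≤ ENNReal.ofReal L := by
    rw [eLpNorm_congr_ae (g := iteratedDeriv β P)]
    · exact (eLpNorm_mono_measure _ Measure.restrict_le_self).trans hL
    · exact (ae_restrict_iff' hI.measurableSet).2 (ae_of_all _ (heq β))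
  refine ⟨⟨hd, fun k _ => ?_, fun a ha b hb => ?_, hle.trans_lt ENNReal.ofReal_lt_top⟩, hle⟩
  · exact hP.contDiffOn.differentiableOn_iteratedDerivWithin
      (by exact_mod_cast ENat.natCast_lt_top k) hU
  · apply ContDiffOn.absolutelyContinuousOnInterval
    have h1 : ContDiff ℝ 1 (iteratedDeriv (β - 1) P) := by
      rw [iteratedDeriv_eq_iterate]
      exact (hP.iterate_deriv (β - 1)).of_le (by exact_mod_cast le_top)
    exact h1.contDiffOn.congr ((heq (β - 1)).mono (hI.uIcc_subset ha hb))

/-- At each point at most one summand is nonzero, so there are no cross terms. It serves both for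
the derivative bound and for the drift. -/
theorem lintegral_enorm_vertexSum_sq_le {N : ℕ} {g : Fin N → ℝ → ℝ} {J : Fin N → Set ℝ}
    (hJ : Pairwise fun i j => Disjoint (J i) (J j)) (hg : ∀ j, ∀ x ∉ J j, g j x = 0)
    (hm : ∀ j, Measurable (g j)) (v : Fin N → Bool) :
    ∫⁻ x, ‖vertexSum g v x‖ₑ ^ 2 ≤ ∑ j, ∫⁻ x, ‖g j x‖ₑ ^ 2 := by
  rw [← lintegral_finsetSum _ fun j _ => (hm j).enorm.pow_const 2]
  refine lintegral_mono fun x => ?_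
  by_cases hx : ∃ j, x ∈ J j
  · obtain ⟨j, hj⟩ := hx
    have : vertexSum g v x = if v j then g j x else 0 := by
      refine Finset.sum_eq_single j (fun i _ hij => ?_) (fun hj => absurd (Finset.mem_univ j) hj)
      rw [hg i x (Set.disjoint_left.1 (hJ hij.symm) hj), ite_self]
    rw [this]
    refine le_trans ?_ (Finset.single_le_sum (f := fun j => ‖g j x‖ₑ ^ 2) (fun _ _ => zero_le)
      (Finset.mem_univ j))
    split_ifs <;> simp
  · push Not at hx
    have : vertexSum g v x = 0 :=
      Finset.sum_eq_zero fun j _ => by rw [hg j x (hx j), ite_self]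
    simp [this]

theorem contDiff_vertexSum {N : ℕ} {f : Fin N → ℝ → ℝ} (hf : ∀ j, ContDiff ℝ ∞ (f j))
    (v : Fin N → Bool) : ContDiff ℝ ∞ (vertexSum f v) := by
  refine ContDiff.sum fun j _ => ?_
  split_ifs
  · exact hf j
  · exact contDiff_const

theorem iteratedDeriv_vertexSum {N : ℕ} {f : Fin N → ℝ → ℝ} (hf : ∀ j, ContDiff ℝ ∞ (f j))
    (v : Fin N → Bool) (k : ℕ) :
    iteratedDeriv k (vertexSum f v) = vertexSum (fun j => iteratedDeriv k (f j)) v := by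
  funext x
  unfold vertexSum
  rw [iteratedDeriv_fun_sum]
  · refine Finset.sum_congr rfl fun j _ => ?_
    split_ifs
    · rfl
    · simp
  · intro j _
    split_ifs
    · exact ((hf j).of_le (by exact_mod_cast le_top)).contDiffAt
    · exact contDiffAt_const

/-! ### Waves on consecutive cells -/

/-- The centres of `N` consecutive cells of half-width `δ`, starting at `a`. -/
noncomputable def cellCenter (a δ : ℝ) {N : ℕ} (j : Fin N) : ℝ := a + (2 * (j : ℝ) + 1) * δ

/-- The cells around `cellCenter a δ`. -/
noncomputable def cell (a δ : ℝ) {N : ℕ} (j : Fin N) : Set ℝ :=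
  Ioo (cellCenter a δ j - δ) (cellCenter a δ j + δ)

theorem pairwise_disjoint_cell {a δ : ℝ} (hδ : 0 ≤ δ) {N : ℕ} :
    Pairwise fun i j : Fin N => Disjoint (cell a δ i) (cell a δ j) := by
  have key : ∀ i j : Fin N, i < j → Disjoint (cell a δ i) (cell a δ j) := by
    intro i j hij
    rw [Set.disjoint_left]
    intro x hi hj
    have h1 : ((i : ℕ) : ℝ) + 1 ≤ (j : ℕ) := by exact_mod_cast hij
    have h2 := hi.2
    have h3 := hj.1
    simp only [cellCenter] at h2 h3
    nlinarith
  intro i j hij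
  rcases lt_or_gt_of_ne hij with h | h
  · exact key i j h
  · exact (key j i h).symm

theorem cell_subset {a δ : ℝ} (hδ : 0 ≤ δ) {N : ℕ} (j : Fin N) :
    cell a δ j ⊆ Icc a (a + 2 * N * δ) := by
  intro x hx
  have h1 : ((j : ℕ) : ℝ) + 1 ≤ N := by exact_mod_cast j.2
  have h0 : (0 : ℝ) ≤ (j : ℕ) := by positivity
  have h2 := hx.1
  have h3 := hx.2
  simp only [cellCenter] at h2 h3
  constructor <;> nlinarith

theorem wave_eq_zero_of_notMem_cell {φ : ℝ → ℝ} (hφ : ∀ x, 1 / 2 ≤ |x| → φ x = 0) (A : ℝ)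
    {a δ : ℝ} (hδ : 0 < δ) {N : ℕ} (j : Fin N) {x : ℝ} (hx : x ∉ cell a δ j) :
    wave φ A (2 * δ)⁻¹ (cellCenter a δ j) x = 0 := by
  rw [wave, hφ, mul_zero]
  rw [abs_mul, abs_of_pos (by positivity), ← div_eq_inv_mul, le_div_iff₀ (by positivity)]
  by_contra hc
  push Not at hc
  have := abs_lt.1 (show |x - cellCenter a δ j| < δ by linarith)
  exact hx ⟨by linarith [this.1], by linarith [this.2]⟩

theorem isPerturbation_wave {I : Set ℝ} {P₀ ψ : ℝ → ℝ} {κ A a δ : ℝ} {N : ℕ}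
    (hd : IsDensity I P₀) (hP₀ : Continuous P₀) (hP₀n : ∀ x, 0 ≤ P₀ x) (hκ : 0 < κ) (hδ : 0 < δ)
    (hI : Icc a (a + 2 * N * δ) ⊆ I) (hc : ∀ x ∈ Icc a (a + 2 * N * δ), P₀ x = κ)
    (hψ : ContDiff ℝ ∞ ψ) (hψc : HasCompactSupport ψ) (hψ1 : ∀ x, |ψ x| ≤ 1)
    (hψ0 : ∀ x, 1 / 2 ≤ |x| → ψ x = 0) (hψi : ∫ x, ψ x = 0) (hA : 0 ≤ A) (hAκ : A ≤ κ / 2) :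
    IsPerturbation I P₀ κ (A ^ 2 * (2 * δ) * ∫ x, ψ x ^ 2) (cell a δ : Fin N → Set ℝ)
      fun j => wave ψ A (2 * δ)⁻¹ (cellCenter a δ j) where
  density := hd
  measurable_base := hP₀.measurable
  nonneg_base := hP₀n
  pos := hκ
  measurableSet j := measurableSet_Ioo
  subset j := (cell_subset hδ.le j).trans hI
  disjoint := pairwise_disjoint_cell hδ.le
  base_eq j x hx := hc x (cell_subset hδ.le j hx)
  measurable j := (contDiff_wave hψ _ _ _).continuous.measurable
  eq_zero j x hx := wave_eq_zero_of_notMem_cell hψ0 A hδ j hx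
  abs_le j x := by
    rw [wave, abs_mul, abs_of_nonneg hA]
    exact (mul_le_of_le_one_right hA (hψ1 _)).trans hAκ
  integrable j := integrable_wave (hψ.continuous.integrable_of_hasCompactSupport hψc) _ _
    (by positivity)
  integral_eq_zero j := by rw [integral_wave _ _ (by positivity), hψi, mul_zero]
  integral_sq j := by rw [integral_wave_sq _ _ (by positivity), inv_inv]

/-- Minkowski splits the smoothness budget `L` evenly between base and perturbation. The last `r`
components coincide and have no drift; an earlier one differs from `P_n` by the whole perturbation.
-/
theorem vertexFamily_mem_smoothFamily {β : ℕ} {I : Set ℝ} (hI : I.OrdConnected)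
    (hI' : (interior I).Nonempty) {N : ℕ} {P₀ : ℝ → ℝ} {κ D : ℝ} {J : Fin N → Set ℝ}
    {f : Fin N → ℝ → ℝ} (h : IsPerturbation I P₀ κ D J f) (hP₀ : ContDiff ℝ ∞ P₀)
    (hf : ∀ j, ContDiff ℝ ∞ (f j)) (hfz : ∀ j, ∀ x ∉ J j, iteratedDeriv β (f j) x = 0) {L : ℝ}
    (hL : 0 < L) (hP₀L : eLpNorm (iteratedDeriv β P₀) 2 volume ≤ ENNReal.ofReal (L / 2))
    (hfL : ∑ j, ∫⁻ x, ‖iteratedDeriv β (f j) x‖ₑ ^ 2 ≤ ENNReal.ofReal ((L / 2) ^ 2))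
    {c : ℝ} {n r : ℕ} (hr : 1 ≤ r) (hrn : r ≤ n) {Δ : ℕ → ℝ} (hΔ : IsRegularSequence c n Δ)
    (hΔf : ∀ i ∈ Icc 1 (n - r), ∑ j, ∫⁻ x, ‖f j x‖ₑ ^ 2 ≤ ENNReal.ofReal (Δ i ^ 2))
    (v : Fin N → Bool) : vertexFamily P₀ f n r v ∈ smoothFamily β L I c n Δ := by
  have hn : n - r < n := by omega
  refine ⟨fun i hi => ?_, fun i hi => ?_, hΔ⟩
  · have hd := h.isDensity_vertexFamily n r v i
    by_cases hir : n - r < i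
    · have e : vertexFamily P₀ f n r v i = P₀ + vertexSum f v := by
        funext x; simp [vertexFamily, hir]
      have hs := contDiff_vertexSum hf v
      rw [e] at hd ⊢
      refine isSmoothDensity_of_contDiff hI hI' (hP₀.add hs) hd ?_
      have hder : iteratedDeriv β (P₀ + vertexSum f v) =
          iteratedDeriv β P₀ + vertexSum (fun j => iteratedDeriv β (f j)) v := by
        rw [← iteratedDeriv_vertexSum hf v]
        funext x
        exact iteratedDeriv_add (hP₀.of_le (by exact_mod_cast le_top)).contDiffAt
          (hs.of_le (by exact_mod_cast le_top)).contDiffAt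
      have hm1 : AEStronglyMeasurable (iteratedDeriv β P₀) volume :=
        (hP₀.continuous_iteratedDeriv β (by exact_mod_cast le_top)).aestronglyMeasurable
      have hm2 : AEStronglyMeasurable (vertexSum (fun j => iteratedDeriv β (f j)) v) volume := by
        rw [← iteratedDeriv_vertexSum hf v]
        exact (hs.continuous_iteratedDeriv β (by exact_mod_cast le_top)).aestronglyMeasurable
      change eLpNorm (iteratedDeriv β (P₀ + vertexSum f v)) 2 volume ≤ _
      rw [hder]
      refine (eLpNorm_add_le hm1 hm2 one_le_two).trans ?_
      rw [show L = L / 2 + L / 2 by ring, ENNReal.ofReal_add (by positivity) (by positivity)]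
      refine add_le_add hP₀L (eLpNorm_two_le_ofReal (by positivity) (le_trans ?_ hfL))
      exact lintegral_enorm_vertexSum_sq_le h.disjoint hfz (fun j =>
        ((hf j).continuous_iteratedDeriv β (by exact_mod_cast le_top)).measurable) v
    · have e : vertexFamily P₀ f n r v i = P₀ := by
        funext x; simp [vertexFamily, hir]
      rw [e]
      exact isSmoothDensity_of_contDiff hI hI' hP₀ h.density
        (hP₀L.trans (ENNReal.ofReal_le_ofReal (by linarith)))
  · unfold L2Dist
    by_cases hir : n - r < i
    · have e : (fun x => vertexFamily P₀ f n r v i x - vertexFamily P₀ f n r v n x) =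
          fun _ => 0 := by
        funext x; simp [vertexFamily, hir, hn]
      rw [e]; simp
    · have e : (fun x => vertexFamily P₀ f n r v i x - vertexFamily P₀ f n r v n x) =
          fun x => -vertexSum f v x := by
        funext x; simp [vertexFamily, hir, hn]
      rw [e]
      refine (eLpNorm_mono_measure _ Measure.restrict_le_self).trans
        (eLpNorm_two_le_ofReal (hΔ.nonneg i hi) (le_trans ?_ (hΔf i ⟨hi.1, by omega⟩)))
      simp only [enorm_neg]
      exact lintegral_enorm_vertexSum_sq_le h.disjoint h.eq_zero h.measurable v

/-! ### The lower bound -/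

theorem exists_pos_scale {κ E F B : ℝ} (hκ : 0 < κ) (hB : 0 < B) :
    ∃ γ : ℝ, 0 < γ ∧ γ ≤ κ / 2 ∧ γ ^ 2 * E ≤ min κ (1 / 2) ∧ γ ^ 2 * F ≤ B := by
  have hlim : ∀ E : ℝ, Filter.Tendsto (fun t : ℝ => t ^ 2 * E) (nhds 0) (nhds 0) := fun E => by
    have : Filter.Tendsto (fun t : ℝ => t ^ 2 * E) (nhds 0) (nhds (0 ^ 2 * E)) :=
      (Filter.tendsto_id.pow 2).mul_const _
    simpa using this
  have h1 : ∀ᶠ γ in nhds (0 : ℝ), γ ≤ κ / 2 := eventually_le_nhds (by positivity)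
  have h2 := (hlim E).eventually_le_const (show 0 < min κ (1 / 2) by positivity)
  have h3 := (hlim F).eventually_le_const hB
  have h4 : ∀ᶠ γ in nhdsWithin (0 : ℝ) (Ioi 0), 0 < γ := self_mem_nhdsWithin
  obtain ⟨γ, ⟨h1, h2, h3⟩, h4⟩ :=
    (((h1.and (h2.and h3)).filter_mono nhdsWithin_le_nhds).and h4).exists
  exact ⟨γ, h4, h1, h2, h3⟩

theorem exists_le_minimaxRisk {β : ℕ} (hβ : 1 ≤ β) {I : Set ℝ} (hI : I.OrdConnected)
    (hI' : (interior I).Nonempty) {L : ℝ} (hL : 0 < L) (c : ℝ) :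
    ∃ C : ℝ, 0 < C ∧ ∀ (n : ℕ) (Δ : ℕ → ℝ) (r : ℕ), IsRegularSequence c n Δ →
      IsGreatest (admissibleWindows β n Δ) r →
        ENNReal.ofReal (C * (r : ℝ) ^ (-(2 * (β : ℝ)) / (2 * β + 1))) ≤
          minimaxRisk β L I c n Δ := by
  obtain ⟨m, hm⟩ := id hI'
  obtain ⟨h₀, hh₀, hball⟩ := Metric.nhds_basis_closedBall.mem_iff.1 (mem_interior_iff_mem_nhds.1 hm)
  rw [Real.closedBall_eq_Icc] at hball
  obtain ⟨P₀, κ, hκ, hP₀, hP₀n, hP₀d, hP₀c, hP₀L⟩ :=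
    exists_base_density hβ hh₀ hball (half_pos hL)
  obtain ⟨ψ, hψ, hψc, hψ1, hψ0, hψi, hE⟩ := exists_mother_bump
  set E := ∫ x, ψ x ^ 2
  set F := ∫ x, iteratedDeriv β ψ x ^ 2 with hF
  -- The bounds on `γ` serve, in turn, `|f j| ≤ κ / 2`, affinity (`κ`) and drift (`1 / 2`), and the
  -- derivative budget `L / 2`.
  obtain ⟨γ, hγ, hγκ, hγE, hγF⟩ := exists_pos_scale (E := 2 * h₀ * E)
    (F := (((2 * h₀)⁻¹) ^ β) ^ 2 * (2 * h₀) * F) hκ (show 0 < (L / 2) ^ 2 by positivity)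
  have hγE1 := hγE.trans (min_le_left _ _)
  have hγE2 := hγE.trans (min_le_right _ _)
  refine ⟨γ ^ 2 * (2 * h₀ * E) / (32 * 4 ^ β), by positivity, fun n Δ r hreg hgr => ?_⟩
  obtain ⟨⟨⟨hr1, hrn⟩, hrΔ⟩, hmax⟩ := hgr
  have hr0 : (1 : ℝ) ≤ r := by exact_mod_cast hr1
  have hβ0 : (0 : ℝ) < 2 * β + 1 := by positivity
  set u : ℝ := (r : ℝ) ^ ((1 : ℝ) / (2 * β + 1)) with hu
  have hu1 : 1 ≤ u := Real.one_le_rpow hr0 (by positivity)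
  have hur : u ^ (2 * β + 1) = r := by
    rw [hu, ← Real.rpow_natCast, ← Real.rpow_mul (by positivity)]
    push_cast
    rw [one_div_mul_cancel hβ0.ne', Real.rpow_one]
  have hre : (r : ℝ) ^ (-(2 * (β : ℝ)) / (2 * β + 1)) = (u ^ (2 * β))⁻¹ := by
    rw [hu, ← Real.rpow_natCast, ← Real.rpow_mul (by positivity), ← Real.rpow_neg (by positivity)]
    congr 1; push_cast; ring
  set N := ⌈u⌉₊ with hN
  have huN : u ≤ N := Nat.le_ceil u
  have hN0 : (0 : ℝ) < N := by linarith
  have hNu : (N : ℝ) ≤ 2 * u := by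
    have := (Nat.ceil_lt_add_one (show 0 ≤ u by linarith)).le
    linarith
  set δ := h₀ / N with hδ
  have hδ0 : 0 < δ := by positivity
  have hcell : m - h₀ + 2 * N * δ = m + h₀ := by rw [hδ]; field_simp; ring
  set A := γ / (N : ℝ) ^ β with hA
  have hNβ : (1 : ℝ) ≤ (N : ℝ) ^ β := one_le_pow₀ (by linarith)
  have hA0 : 0 < A := by positivity
  have hpert := isPerturbation_wave (N := N) (a := m - h₀) hP₀d hP₀.continuous hP₀n hκ hδ0
    (by rwa [hcell]) (by rwa [hcell]) hψ hψc hψ1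
    (fun x hx => by simpa using hψ0 0 x hx) hψi hA0.le ((div_le_self hγ.le hNβ).trans hγκ)
  have hD : A ^ 2 * (2 * δ) * E = γ ^ 2 * (2 * h₀ * E) * ((N : ℝ) ^ (2 * β + 1))⁻¹ := by
    rw [hA, hδ]; field_simp; ring
  have hND : (N : ℝ) * (A ^ 2 * (2 * δ) * E) = γ ^ 2 * (2 * h₀ * E) * ((N : ℝ) ^ (2 * β))⁻¹ := by
    rw [hD]; field_simp; ring
  -- Here `N ≥ u` matters: `N ^ (2β + 1) ≥ u ^ (2β + 1) = r`.
  have hDr : A ^ 2 * (2 * δ) * E ≤ κ / r := by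
    rw [hD, div_eq_mul_inv, ← hur]
    gcongr
  have hmem : ∀ v, vertexFamily P₀ (fun j : Fin N => wave ψ A (2 * δ)⁻¹ (cellCenter (m - h₀) δ j))
      n r v ∈ smoothFamily β L I c n Δ := by
    refine vertexFamily_mem_smoothFamily hI hI' hpert hP₀ (fun j => contDiff_wave hψ _ _ _)
      (fun j x hx => ?_) hL hP₀L ?_ hr1 hrn hreg ?_
    · rw [iteratedDeriv_wave hψ]
      exact wave_eq_zero_of_notMem_cell (hψ0 β) _ hδ0 j hx
    · simp_rw [iteratedDeriv_wave hψ, lintegral_enorm_wave_sq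
        (integrable_iteratedDeriv_sq hψ hψc β) _ _ (show 0 < (2 * δ)⁻¹ by positivity)]
      rw [Finset.sum_const, Finset.card_univ, Fintype.card_fin, nsmul_eq_mul,
        ← ENNReal.ofReal_natCast, ← ENNReal.ofReal_mul (by positivity)]
      apply ENNReal.ofReal_le_ofReal
      -- The powers of `N` cancel: `N` cells, amplitude `N ^ (-β)`, `β` derivatives at frequency
      -- proportional to `N`, and width proportional to `1 / N`.
      refine le_trans (le_of_eq ?_) hγF
      rw [← hF, hA, hδ, show (2 * (h₀ / N))⁻¹ = (2 * h₀)⁻¹ * (N : ℝ) by field_simp,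
        mul_pow (2 * h₀)⁻¹ (N : ℝ) β, mul_inv ((2 * h₀)⁻¹) (N : ℝ), inv_inv]
      generalize (2 * h₀)⁻¹ ^ β = q
      field_simp
    · intro i hi
      have hψ2 : Integrable fun x => ψ x ^ 2 := by
        simpa using integrable_iteratedDeriv_sq hψ hψc 0
      simp_rw [lintegral_enorm_wave_sq hψ2 _ _ (show 0 < (2 * δ)⁻¹ by positivity)]
      rw [Finset.sum_const, Finset.card_univ, Fintype.card_fin, nsmul_eq_mul,
        ← ENNReal.ofReal_natCast, ← ENNReal.ofReal_mul (by positivity), inv_inv, hND]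
      apply ENNReal.ofReal_le_ofReal
      have hrn' : r + 1 ≤ n := by have := hi.1.trans hi.2; omega
      -- Maximality of `r`: the window `r + 1` starts at index `n - r` and is not admissible.
      have hlt : (1 / ((r : ℝ) + 1)) ^ ((β : ℝ) / (2 * β + 1)) < Δ (n - r) := by
        by_contra hc
        push Not at hc
        have : r + 1 ∈ admissibleWindows β n Δ := by
          refine ⟨⟨by omega, hrn'⟩, ?_⟩
          rw [show n - (r + 1) + 1 = n - r by omega]
          push_cast
          exact hc
        have := hmax this
        omega
      have hΔi : Δ (n - r) ≤ Δ i :=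
        hreg.antitone ⟨hi.1, by have := hi.2; omega⟩ ⟨by omega, by omega⟩ hi.2
      calc γ ^ 2 * (2 * h₀ * E) * ((N : ℝ) ^ (2 * β))⁻¹ ≤ 1 / 2 * (u ^ (2 * β))⁻¹ := by gcongr
        _ ≤ ((1 / ((r : ℝ) + 1)) ^ ((β : ℝ) / (2 * β + 1))) ^ 2 := by
          rw [← hre, ← Real.rpow_natCast (_ ^ _), ← Real.rpow_mul (by positivity)]
          set e : ℝ := (β : ℝ) / (2 * β + 1) * (2 : ℕ) with he
          have he1 : e ≤ 1 := by
            rw [he, div_mul_eq_mul_div, div_le_one hβ0]; push_cast; linarith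
          have he0 : 0 ≤ e := by positivity
          have : -(2 * (β : ℝ)) / (2 * β + 1) = -e := by rw [he]; push_cast; ring
          rw [this, Real.rpow_neg (by positivity), ← Real.inv_rpow (by positivity)]
          -- The factor `1/2` pays for passing from `r` to `r + 1`: since `e ≤ 1` it is at most
          -- `(1/2) ^ e`, and `2r ≥ r + 1`.
          calc 1 / 2 * ((r : ℝ)⁻¹) ^ e ≤ (1 / 2) ^ e * ((r : ℝ)⁻¹) ^ e := by
                gcongr
                exact Real.self_le_rpow_of_le_one (by norm_num) (by norm_num) he1
            _ = (1 / 2 * (r : ℝ)⁻¹) ^ e := (Real.mul_rpow (by norm_num) (by positivity)).symm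
            _ ≤ (1 / ((r : ℝ) + 1)) ^ e := by
                apply Real.rpow_le_rpow (by positivity) _ he0
                rw [← one_div, one_div_mul_one_div]
                exact one_div_le_one_div_of_le (by positivity) (by linarith)
        _ ≤ Δ i ^ 2 := by
          gcongr
          exact hlt.le.trans hΔi
  refine le_iInf fun T => ?_
  refine le_trans ?_ ((hpert.le_iSup_risk hr1 hrn hDr (by positivity) T).trans
    (iSup_le fun v => le_iSup₂_of_le _ (hmem v) le_rfl))
  apply ENNReal.ofReal_le_ofReal
  rw [hND, hre]
  -- The factor `4 ^ β` comes from `N ≤ 2u`, and 32 from Assouad's bound.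
  calc γ ^ 2 * (2 * h₀ * E) / (32 * 4 ^ β) * (u ^ (2 * β))⁻¹
      = γ ^ 2 * (2 * h₀ * E) * ((2 * u) ^ (2 * β))⁻¹ / 32 := by
        rw [mul_pow, pow_mul 2 2 β]; norm_num; field_simp
    _ ≤ _ := by gcongr

end DriftDensity

theorem theorem3 (β : ℕ) (hβ : 1 ≤ β)
    (I : Set ℝ) (hI : I.OrdConnected) (hI' : (interior I).Nonempty)
    (L : ℝ) (hL : 0 < L) (c : ℝ) :
    ∃ C₁ C₂ : ℝ, 0 < C₁ ∧ 0 < C₂ ∧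
      ∀ (n : ℕ) (Δ : ℕ → ℝ) (r : ℕ), 1 ≤ n →
        DriftDensity.IsRegularSequence c n Δ →
        IsGreatest (DriftDensity.admissibleWindows β n Δ) r →
          ENNReal.ofReal (C₁ * (r : ℝ) ^ (-(2 * (β : ℝ)) / (2 * β + 1)))
              ≤ DriftDensity.minimaxRisk β L I c n Δ ∧
            DriftDensity.minimaxRisk β L I c n Δ
              ≤ ENNReal.ofReal (C₂ * (r : ℝ) ^ (-(2 * (β : ℝ)) / (2 * β + 1))) := by
  obtain ⟨C₁, h₁, H₁⟩ := DriftDensity.exists_le_minimaxRisk hβ hI hI' hL c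
  obtain ⟨C₂, h₂, H₂⟩ := DriftDensity.exists_minimaxRisk_le hβ hI hI' hL c
  exact ⟨C₁, C₂, h₁, h₂, fun n Δ r _ hreg hr => ⟨H₁ n Δ r hreg hr, H₂ n Δ r hreg hr.1⟩⟩
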